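/- Let $(M,g)$ be a smooth Lorentzian manifold (signature $(-,+,\dots,+)$) of dimension $n\ge 4$ with Levi-Civita connection $\nabla$. Suppose that it is a pp-wave: there is a smooth nowhere zero null vector field $X$ that is covariantly constant ($X^iX_i=0$, $\nabla_jX_k=0$), and the curvature tensor satisfies $R_{jk}{}^{pq}R_{pqlm}=0$. Here $R_{kl}=-R_{pkl}{}^{p}$ is the Ricci tensor, $R=g^{kl}R_{kl}$ is the scalar curvature, $$C_{jklm}=R_{jklm}+\tfrac1{n-2}\left(g_{jm}R_{kl}-g_{km}R_{jl}+g_{kl}R_{jm}-g_{jl}R_{km}\right)-R\,\frac{g_{jm}g_{kl}-g_{km}g_{jl}}{(n-1)(n-2)}$$ is the Weyl tensor, the sign of $R_{jkl}{}^m$ is the one for which $R_{kl}$ is positive on round spheres, and $\nabla^2=\nabla^p\nabla_p$. Then: 1. The Ricci tensor is recurrent with a closed recurrence 1-form where it does not vanish: on the open set $U\subseteq M$ of the points where the Ricci tensor is non-zero there is a smooth closed 1-form $\omega$ (possibly zero) with $\nabla_jR_{kl}=\omega_jR_{kl}$ on $U$. 2. $[\nabla_i,\nabla_j]R_{kl}=\nabla_i\nabla_jR_{kl}-\nabla_j\nabla_iR_{kl}=0$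 on $M$. 3. $\nabla^j\nabla^mC_{jklm}=-\frac{n-3}{n-2}\,\nabla^2R_{kl}$ on $M$. In particular, at each point and for each component in each chart, $\nabla^2R_{kl}=0$ if and only if $\nabla^j\nabla^mC_{jklm}=0$. -/

import Mathlib

open scoped Manifold ContDiff
open Bundle

noncomputable section

namespace PPWave

/-- The model space `ℝⁿ`, in which charts take their values. -/
abbrev Coord (n : ℕ) : Type := EuclideanSpace ℝ (Fin n)

/-! ### Tensor calculus in coordinates

A covariant tensor field of rank `r` is represented in a chart by its components
`T y a`, where `y` is the coordinate point and `a : Fin r → Fin n` lists the indices.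
The argument `G` below is always the matrix `(g_ij)` of a metric in a chart. -/

section Coordinates

variable {n : ℕ}

/-- The partial derivative `∂_i f` at `y`. -/
def pd (i : Fin n) (f : Coord n → ℝ) (y : Coord n) : ℝ :=
  fderiv ℝ f y (EuclideanSpace.single i 1)

/-- The Christoffel symbols `Γ^m_{ij} = ½ g^{mp} (∂_i g_{jp} + ∂_j g_{ip} - ∂_p g_{ij})`,
as `christoffel G y m i j`. -/
def christoffel (G : Coord n → Matrix (Fin n) (Fin n) ℝ) (y : Coord n) (m i j : Fin n) : ℝ :=
  (1 / 2 : ℝ) * ∑ p, (G y)⁻¹ m p *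
    (pd i (fun z => G z j p) y + pd j (fun z => G z i p) y - pd p (fun z => G z i j) y)

/-- The Levi-Civita covariant derivative of a covariant tensor field of rank `r`:
`(∇T)_{j a₁ … a_r} = ∂_j T_{a₁ … a_r} - ∑_s Γ^m_{j a_s} T_{a₁ … m … a_r}`
(with `m` in place of `a_s`). The new index is the first one, so that iterating gives
`covD G (covD G T) y ![i, j, …] = ∇_i ∇_j T_…`. -/
def covD (G : Coord n → Matrix (Fin n) (Fin n) ℝ) {r : ℕ}
    (T : Coord n → (Fin r → Fin n) → ℝ) :
    Coord n → (Fin (r + 1) → Fin n) → ℝ :=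
  fun y a => pd (a 0) (fun z => T z (Fin.tail a)) y -
    ∑ s : Fin r, ∑ m : Fin n,
      christoffel G y m (a 0) (Fin.tail a s) * T y (Function.update (Fin.tail a) s m)

/-- The curvature tensor `R_{jkl}{}^m`, as `riemann G y j k l m`, with the sign for which
`R_{ij} = - R_{kij}{}^k` is the usual Ricci tensor (positive on round spheres):
`R_{jkl}{}^m = ∂_k Γ^m_{jl} - ∂_j Γ^m_{kl} + Γ^m_{kp} Γ^p_{jl} - Γ^m_{jp} Γ^p_{kl}`. -/
def riemann (G : Coord n → Matrix (Fin n) (Fin n) ℝ) (y : Coord n) (j k l m : Fin n) : ℝ :=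
  pd k (fun z => christoffel G z m j l) y - pd j (fun z => christoffel G z m k l) y +
    ∑ p, (christoffel G y m k p * christoffel G y p j l -
      christoffel G y m j p * christoffel G y p k l)

/-- The curvature tensor with all indices lowered, `R_{jklm} = g_{mp} R_{jkl}{}^p`. -/
def riemannLow (G : Coord n → Matrix (Fin n) (Fin n) ℝ) (y : Coord n) (j k l m : Fin n) : ℝ :=
  ∑ p, G y m p * riemann G y j k l p

/-- The Ricci tensor `R_{kl} = - R_{pkl}{}^p`. -/
def ricci (G : Coord n → Matrix (Fin n) (Fin n) ℝ) (y : Coord n) (k l : Fin n) : ℝ :=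
  - ∑ p, riemann G y p k l p

/-- The scalar curvature `R = g^{kl} R_{kl}`. -/
def scalarCurv (G : Coord n → Matrix (Fin n) (Fin n) ℝ) (y : Coord n) : ℝ :=
  ∑ k, ∑ l, (G y)⁻¹ k l * ricci G y k l

/-- The Weyl tensor `C_{jklm}`. -/
def weyl (G : Coord n → Matrix (Fin n) (Fin n) ℝ) (y : Coord n) (j k l m : Fin n) : ℝ :=
  riemannLow G y j k l m +
    1 / ((n : ℝ) - 2) * (G y j m * ricci G y k l - G y k m * ricci G y j l +
      G y k l * ricci G y j m - G y j l * ricci G y k m) -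
    scalarCurv G y * (G y j m * G y k l - G y k m * G y j l) / (((n : ℝ) - 1) * ((n : ℝ) - 2))

/-- `∇_j R_{kl}`. -/
def covRicci (G : Coord n → Matrix (Fin n) (Fin n) ℝ) (y : Coord n) (j k l : Fin n) : ℝ :=
  covD G (fun z (a : Fin 2 → Fin n) => ricci G z (a 0) (a 1)) y ![j, k, l]

/-- `∇_i ∇_j R_{kl}`. -/
def covCovRicci (G : Coord n → Matrix (Fin n) (Fin n) ℝ) (y : Coord n) (i j k l : Fin n) : ℝ :=
  covD G (covD G (fun z (a : Fin 2 → Fin n) => ricci G z (a 0) (a 1))) y ![i, j, k, l]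

/-- `∇² R_{kl} = ∇^p ∇_p R_{kl} = g^{pq} ∇_p ∇_q R_{kl}`. -/
def laplacianRicci (G : Coord n → Matrix (Fin n) (Fin n) ℝ) (y : Coord n) (k l : Fin n) : ℝ :=
  ∑ p, ∑ q, (G y)⁻¹ p q * covCovRicci G y p q k l

/-- `∇_p ∇_q C_{jklm}`. -/
def covCovWeyl (G : Coord n → Matrix (Fin n) (Fin n) ℝ) (y : Coord n)
    (p q j k l m : Fin n) : ℝ :=
  covD G (covD G (fun z (a : Fin 4 → Fin n) => weyl G z (a 0) (a 1) (a 2) (a 3))) y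
    ![p, q, j, k, l, m]

/-- The double divergence `∇^j ∇^m C_{jklm} = g^{jp} g^{mq} ∇_p ∇_q C_{jklm}`. -/
def divDivWeyl (G : Coord n → Matrix (Fin n) (Fin n) ℝ) (y : Coord n) (k l : Fin n) : ℝ :=
  ∑ j, ∑ m, ∑ p, ∑ q, (G y)⁻¹ j p * (G y)⁻¹ m q * covCovWeyl G y p q j k l m

end Coordinates

/-! ### Lorentzian manifolds -/

section Manifold

variable {n : ℕ} {M : Type*} [TopologicalSpace M] [ChartedSpace (Coord n) M]
  [IsManifold (𝓡 n) ∞ M]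

variable (n M) in
/-- A smooth Lorentzian metric, of signature `(-, +, …, +)`. -/
structure LorentzMetric where
  /-- The bilinear form on each tangent space. -/
  inner (p : M) : TangentSpace (𝓡 n) p →L[ℝ] TangentSpace (𝓡 n) p →L[ℝ] ℝ
  symm (p : M) (v w : TangentSpace (𝓡 n) p) : inner p v w = inner p w v
  signature (p : M) : ∃ b : Module.Basis (Fin n) ℝ (TangentSpace (𝓡 n) p),
    ∀ i j, inner p (b i) (b j) = if i = j then (if (i : ℕ) = 0 then -1 else 1) else 0
  contMDiff : ContMDiff (𝓡 n) ((𝓡 n).prod 𝓘(ℝ, Coord n →L[ℝ] Coord n →L[ℝ] ℝ)) ∞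
    (fun p ↦ TotalSpace.mk' (Coord n →L[ℝ] Coord n →L[ℝ] ℝ) p (inner p))

variable (n M) in
/-- The charts of the smooth structure of `M` (all of them, not only those of a given atlas). -/
def charts : Set (OpenPartialHomeomorph M (Coord n)) :=
  IsManifold.maximalAtlas (𝓡 n) ∞ M

/-- The coordinate vector `∂_i` of the chart `φ` at the point with coordinates `y`. -/
def coordVec (φ : OpenPartialHomeomorph M (Coord n)) (y : Coord n) (i : Fin n) :
    TangentSpace (𝓡 n) (φ.symm y) :=
  mfderiv 𝓘(ℝ, Coord n) (𝓡 n) φ.symm y (EuclideanSpace.single i (1 : ℝ) : Coord n)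

/-- The matrix `g_ij = g(∂_i, ∂_j)` of the metric in the chart `φ`. -/
def LorentzMetric.comp (g : LorentzMetric n M) (φ : OpenPartialHomeomorph M (Coord n))
    (y : Coord n) : Matrix (Fin n) (Fin n) ℝ :=
  Matrix.of fun i j => g.inner (φ.symm y) (coordVec φ y i) (coordVec φ y j)

/-- The components `θ_j = θ(∂_j)` of a 1-form in the chart `φ`. -/
def formComp (θ : (p : M) → TangentSpace (𝓡 n) p →L[ℝ] ℝ)
    (φ : OpenPartialHomeomorph M (Coord n)) (y : Coord n) (j : Fin n) : ℝ :=
  θ (φ.symm y) (coordVec φ y j)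

/-- The 1-form `θ` is smooth on `U`. -/
def SmoothFormOn (θ : (p : M) → TangentSpace (𝓡 n) p →L[ℝ] ℝ) (U : Set M) : Prop :=
  ContMDiffOn (𝓡 n) ((𝓡 n).prod 𝓘(ℝ, Coord n →L[ℝ] ℝ)) ∞
    (fun p ↦ TotalSpace.mk' (Coord n →L[ℝ] ℝ) p (θ p)) U

/-- The 1-form `θ` is closed on the open set `U`: `∂_i θ_j = ∂_j θ_i` in every chart. -/
def ClosedFormOn (θ : (p : M) → TangentSpace (𝓡 n) p →L[ℝ] ℝ) (U : Set M) : Prop :=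
  ∀ φ ∈ charts n M, ∀ y ∈ φ.target, φ.symm y ∈ U → ∀ i j,
    pd i (fun z => formComp θ φ z j) y = pd j (fun z => formComp θ φ z i) y

/-- `X` is a smooth, nowhere zero, null vector field which is covariantly constant:
`X^i X_i = 0` and `∇_j X_k = 0`, where `X_k = g_{ki} X^i`. -/
structure LorentzMetric.IsParallelNull (g : LorentzMetric n M)
    (X : (p : M) → TangentSpace (𝓡 n) p) : Prop where
  contMDiff : ContMDiff (𝓡 n) (𝓡 n).tangent ∞
    (fun p ↦ (⟨p, X p⟩ : TangentBundle (𝓡 n) M))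
  ne_zero (p : M) : X p ≠ 0
  null (p : M) : g.inner p (X p) (X p) = 0
  parallel : ∀ φ ∈ charts n M, ∀ y ∈ φ.target, ∀ j k : Fin n,
    covD (g.comp φ) (fun z (a : Fin 1 → Fin n) =>
      formComp (fun p => g.inner p (X p)) φ z (a 0)) y ![j, k] = 0

/-- A pp-wave is a Brinkmann wave (a Lorentzian manifold with a covariantly constant null vector
field) whose curvature tensor satisfies `R_{jk}{}^{pq} R_{pqlm} = 0`. -/
def LorentzMetric.IsPPWave (g : LorentzMetric n M) : Prop :=
  (∃ X : (p : M) → TangentSpace (𝓡 n) p, g.IsParallelNull X) ∧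
  ∀ φ ∈ charts n M, ∀ y ∈ φ.target, ∀ j k l m : Fin n,
    ∑ p, ∑ q, ∑ a, ∑ b, (g.comp φ y)⁻¹ p a * (g.comp φ y)⁻¹ q b *
      riemannLow (g.comp φ) y j k a b * riemannLow (g.comp φ) y p q l m = 0

/-- The set of points of `M` at which the Ricci tensor is not zero. -/
def LorentzMetric.ricciNonzeroSet (g : LorentzMetric n M) : Set M :=
  {p | ∃ φ ∈ charts n M, p ∈ φ.source ∧ ∃ k l, ricci (g.comp φ) (φ p) k l ≠ 0}

/-- The Ricci tensor is recurrent on the set `U` with recurrence 1-form `θ`: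
`∇_j R_{kl} = θ_j R_{kl}` at the points of `U`. -/
def LorentzMetric.RicciRecurrentOn (g : LorentzMetric n M)
    (θ : (p : M) → TangentSpace (𝓡 n) p →L[ℝ] ℝ) (U : Set M) : Prop :=
  ∀ φ ∈ charts n M, ∀ y ∈ φ.target, φ.symm y ∈ U → ∀ j k l,
    covRicci (g.comp φ) y j k l = formComp θ φ y j * ricci (g.comp φ) y k l

end Manifold

end PPWave

end

namespace PPWave

open Matrix Filter Topology

/-! ### Partial derivatives and entrywise calculus of matrix functions. -/

section Calculus

variable {n : ℕ} {f h : Coord n → ℝ} {y : Coord n} {i j : Fin n}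

/-! Let ξ be the parallel null 1-form dual to X. Since ∇ξ = 0, commuting second derivatives of ξ
shows that the curvature annihilates ξ. For fixed j, k the pp-wave condition with (l, m) = (j, k)
says that the bivector R_{jk··} has zero square norm. In Lorentzian signature a bivector that
annihilates a null covector ξ and has zero square is of the form ξ ∧ v
(`antisymm_divisible_by_null`, `exists_null_complement`). Dividing by ξ in both pairs of indices and
tracing gives R_{kl} = ψ ξ_k ξ_l (`exists_ricci_eq`). Both sides are tensors, so ψ is a function on
M (`exists_global_factor`), smooth because ξ has no zeros.

Everything else is calculus with ψ. As ξ is parallel, ∇_j R_{kl} = ∂_jψ ξ_k ξ_l and ∇_i∇_j R_{kl} =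
(∇_i∇_jψ) ξ_k ξ_l. Hence the recurrence form is dψ/ψ, which is closed, and the commutator vanishes
because the Hessian is symmetric.

For the Weyl tensor, nullity of ξ gives R = 0, and the twice contracted Bianchi identity then
becomes ξ^p ∂_pψ = 0 (`sum_inv_mul_pd`). The once contracted identity ∇^m R_{jklm} = ∇_k R_{jl} -
∇_j R_{kl} leads to ∇^m C_{jklm} = -(n-3)/(n-2) (∂_jψ ξ_k - ∂_kψ ξ_j) ξ_l (`div_weyl`). In the
second divergence the first term gives the Laplacian of the Ricci tensor, and the other contains ξ^j
∇_j∇_kψ, which vanishes on differentiating ξ^p ∂_pψ = 0 (`hessian_null`).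

The connection and curvature are treated as matrices acting on the vector index, so that the
structure equation, Bianchi identities and transformation laws become noncommutative matrix algebra.
-/

theorem differentiableAt_of_smooth (hf : ContDiffAt ℝ ∞ f y) : DifferentiableAt ℝ f y :=
  hf.differentiableAt (by simp)

theorem pd_congr (hfh : f =ᶠ[𝓝 y] h) : pd i f y = pd i h y := by
  simp only [pd, hfh.fderiv_eq]

@[simp] theorem pd_const (c : ℝ) : pd i (fun _ => c) y = 0 := by simp [pd]

theorem pd_add (hf : DifferentiableAt ℝ f y) (hh : DifferentiableAt ℝ h y) :
    pd i (fun z => f z + h z) y = pd i f y + pd i h y := by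
  simp [pd, fderiv_fun_add hf hh]

theorem pd_neg : pd i (fun z => -f z) y = -pd i f y := by
  simp [pd, fderiv_fun_neg]

theorem pd_sub (hf : DifferentiableAt ℝ f y) (hh : DifferentiableAt ℝ h y) :
    pd i (fun z => f z - h z) y = pd i f y - pd i h y := by
  simp [pd, fderiv_fun_sub hf hh]

theorem pd_mul (hf : DifferentiableAt ℝ f y) (hh : DifferentiableAt ℝ h y) :
    pd i (fun z => f z * h z) y = pd i f y * h y + f y * pd i h y := by
  simp [pd, fderiv_fun_mul hf hh]; ring

theorem pd_const_mul (c : ℝ) (hf : DifferentiableAt ℝ f y) :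
    pd i (fun z => c * f z) y = c * pd i f y := by
  simp [pd_mul (differentiableAt_const c) hf]

theorem pd_sum {ι : Type*} {u : Finset ι} {F : ι → Coord n → ℝ}
    (hF : ∀ a ∈ u, DifferentiableAt ℝ (F a) y) :
    pd i (fun z => ∑ a ∈ u, F a z) y = ∑ a ∈ u, pd i (F a) y := by
  simp [pd, fderiv_fun_sum hF]

theorem smooth_pd (hf : ContDiffAt ℝ ∞ f y) : ContDiffAt ℝ ∞ (pd i f) y :=
  (hf.fderiv_right (m := ∞) (by simp)).clm_apply contDiffAt_const

theorem pd_comm (hf : ContDiffAt ℝ ∞ f y) : pd i (pd j f) y = pd j (pd i f) y := by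
  have h1 : DifferentiableAt ℝ (fderiv ℝ f) y :=
    (hf.fderiv_right (m := ∞) (by simp)).differentiableAt (by simp)
  have h2 : ∀ a b : Fin n, pd a (pd b f) y =
      fderiv ℝ (fderiv ℝ f) y (EuclideanSpace.single a 1) (EuclideanSpace.single b 1) := by
    intro a b
    change fderiv ℝ (fun z => fderiv ℝ f z (EuclideanSpace.single b 1)) y _ = _
    rw [fderiv_clm_apply h1 (differentiableAt_const _)]
    simp
  rw [h2, h2]
  have h3 : IsSymmSndFDerivAt ℝ f y := hf.isSymmSndFDerivAt (by
    simp only [minSmoothness_of_isRCLikeNormedField]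
    exact WithTop.coe_le_coe.2 le_top)
  exact h3 _ _

theorem smooth_sum {ι : Type*} {u : Finset ι} {F : ι → Coord n → ℝ}
    (hF : ∀ a ∈ u, ContDiffAt ℝ ∞ (F a) y) : ContDiffAt ℝ ∞ (fun z => ∑ a ∈ u, F a z) y :=
  ContDiffAt.sum hF

/-- The chain rule in coordinates. -/
theorem pd_comp {τ : Coord n → Coord n} (hf : DifferentiableAt ℝ f (τ y))
    (hτ : DifferentiableAt ℝ τ y) :
    pd i (fun z => f (τ z)) y = ∑ a, pd a f (τ y) * pd i (fun z => τ z a) y := by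
  have h1 : fderiv ℝ (fun z => f (τ z)) y = (fderiv ℝ f (τ y)).comp (fderiv ℝ τ y) :=
    fderiv_comp y hf hτ
  have h2 : ∀ a, pd i (fun z => τ z a) y = (fderiv ℝ τ y (EuclideanSpace.single i 1)) a := by
    intro a
    have h3 : HasFDerivAt (fun z => τ z a)
        ((EuclideanSpace.proj a : Coord n →L[ℝ] ℝ).comp (fderiv ℝ τ y)) y :=
      (EuclideanSpace.proj a : Coord n →L[ℝ] ℝ).hasFDerivAt.comp y hτ.hasFDerivAt
    simp [pd, h3.fderiv]
  simp only [h2]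
  rw [pd, h1]
  set v := fderiv ℝ τ y (EuclideanSpace.single i 1) with hv
  have h4 : v = ∑ a, v a • (EuclideanSpace.single a (1 : ℝ) : Coord n) := by
    have := (EuclideanSpace.basisFun (Fin n) ℝ).sum_repr v
    simpa using this.symm
  simp only [ContinuousLinearMap.comp_apply, ← hv]
  conv_lhs => rw [h4]
  simp [pd, map_sum, mul_comm]

/-- Entrywise partial derivative of a matrix valued function. -/
noncomputable def mpd {n : ℕ} (i : Fin n) (F : Coord n → Matrix (Fin n) (Fin n) ℝ) (y : Coord n) :
    Matrix (Fin n) (Fin n) ℝ :=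
  Matrix.of fun a b => pd i (fun z => F z a b) y

/-- Entrywise smoothness of a matrix valued function. -/
def MSmooth {n : ℕ} (F : Coord n → Matrix (Fin n) (Fin n) ℝ) (y : Coord n) : Prop :=
  ∀ a b, ContDiffAt ℝ ∞ (fun z => F z a b) y

variable {F H : Coord n → Matrix (Fin n) (Fin n) ℝ}

@[simp] theorem mpd_apply (a b : Fin n) : mpd i F y a b = pd i (fun z => F z a b) y := rfl

theorem MSmooth.differentiableAt (hF : MSmooth F y) (a b : Fin n) :
    DifferentiableAt ℝ (fun z => F z a b) y := differentiableAt_of_smooth (hF a b)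

theorem MSmooth.mpd (hF : MSmooth F y) : MSmooth (mpd i F) y := fun a b => smooth_pd (hF a b)

theorem MSmooth.add (hF : MSmooth F y) (hH : MSmooth H y) : MSmooth (fun z => F z + H z) y :=
  fun a b => (hF a b).add (hH a b)

theorem MSmooth.sub (hF : MSmooth F y) (hH : MSmooth H y) : MSmooth (fun z => F z - H z) y :=
  fun a b => (hF a b).sub (hH a b)

theorem MSmooth.mul (hF : MSmooth F y) (hH : MSmooth H y) : MSmooth (fun z => F z * H z) y := by
  intro a b
  simp only [Matrix.mul_apply]
  exact smooth_sum fun c _ => (hF a c).mul (hH c b)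

theorem MSmooth.transpose (hF : MSmooth F y) : MSmooth (fun z => (F z)ᵀ) y :=
  fun a b => hF b a

theorem mpd_congr (hFH : F =ᶠ[𝓝 y] H) : mpd i F y = mpd i H y := by
  ext a b
  exact pd_congr (hFH.mono fun z hz => by simp [hz])

theorem mpd_add (hF : MSmooth F y) (hH : MSmooth H y) :
    mpd i (fun z => F z + H z) y = mpd i F y + mpd i H y := by
  ext a b
  exact pd_add (hF.differentiableAt a b) (hH.differentiableAt a b)

theorem mpd_sub (hF : MSmooth F y) (hH : MSmooth H y) :
    mpd i (fun z => F z - H z) y = mpd i F y - mpd i H y := by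
  ext a b
  exact pd_sub (hF.differentiableAt a b) (hH.differentiableAt a b)

theorem mpd_mul (hF : MSmooth F y) (hH : MSmooth H y) :
    mpd i (fun z => F z * H z) y = mpd i F y * H y + F y * mpd i H y := by
  ext a b
  simp only [Matrix.mul_apply, mpd_apply, Matrix.add_apply]
  rw [pd_sum (F := fun c z => F z a c * H z c b)
      fun c _ => (hF.differentiableAt a c).fun_mul (hH.differentiableAt c b),
    ← Finset.sum_add_distrib]
  exact Finset.sum_congr rfl fun c _ => pd_mul (hF.differentiableAt a c) (hH.differentiableAt c b)

theorem mpd_transpose : mpd i (fun z => (F z)ᵀ) y = (mpd i F y)ᵀ := rfl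

theorem mpd_comm (hF : MSmooth F y) : mpd i (mpd j F) y = mpd j (mpd i F) y := by
  ext a b
  exact pd_comm (hF a b)

theorem smooth_det {m : ℕ} {K : Coord n → Matrix (Fin m) (Fin m) ℝ}
    (hK : ∀ a b, ContDiffAt ℝ ∞ (fun z => K z a b) y) :
    ContDiffAt ℝ ∞ (fun z => (K z).det) y := by
  simp only [Matrix.det_apply']
  exact smooth_sum fun σ _ => contDiffAt_const.mul (contDiffAt_prod fun a _ => hK _ _)

/-- Cramer's rule: the entries of the inverse are quotients of determinants, which are polynomial in
the entries of `F`. -/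
theorem MSmooth.inv (hF : MSmooth F y) (hdet : (F y).det ≠ 0) : MSmooth (fun z => (F z)⁻¹) y := by
  intro a b
  have h1 : ∀ z, (F z)⁻¹ a b = ((F z).det)⁻¹ * ((F z).updateRow b (Pi.single a 1)).det := by
    intro z
    rw [Matrix.inv_def, Ring.inverse_eq_inv', Matrix.smul_apply, Matrix.adjugate_apply, smul_eq_mul]
  simp only [h1]
  refine ((smooth_det hF).inv hdet).mul (smooth_det fun c d => ?_)
  by_cases hc : c = b
  · subst hc
    simp only [Matrix.updateRow_self]
    exact contDiffAt_const
  · simp only [Matrix.updateRow_ne hc]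
    exact hF c d

end Calculus

/-- `G` is the matrix of a smooth pseudo-Riemannian metric on the open set `s` of `ℝⁿ`. -/
structure IsMetricOn {n : ℕ} (G : Coord n → Matrix (Fin n) (Fin n) ℝ) (s : Set (Coord n)) :
    Prop where
  isOpen : IsOpen s
  smooth : ∀ y ∈ s, MSmooth G y
  symm : ∀ y ∈ s, (G y)ᵀ = G y
  det_ne_zero : ∀ y ∈ s, (G y).det ≠ 0

/-- The matrix `(Γ^m_{jl})_{ml}`. -/
noncomputable def conn {n : ℕ} (G : Coord n → Matrix (Fin n) (Fin n) ℝ) (j : Fin n) (y : Coord n) :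
    Matrix (Fin n) (Fin n) ℝ :=
  Matrix.of fun m l => christoffel G y m j l

/-- The matrix `(R_{jkl}{}^m)_{ml}`. -/
noncomputable def curv {n : ℕ} (G : Coord n → Matrix (Fin n) (Fin n) ℝ) (j k : Fin n)
    (y : Coord n) : Matrix (Fin n) (Fin n) ℝ :=
  Matrix.of fun m l => riemann G y j k l m

/-! ### The Levi-Civita connection, its uniqueness and the symmetries of its curvature. -/

section LeviCivita

variable {n : ℕ} {G : Coord n → Matrix (Fin n) (Fin n) ℝ} {s : Set (Coord n)} {y : Coord n}

theorem conn_apply (j m l : Fin n) : conn G j y m l = christoffel G y m j l := rfl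

theorem curv_apply (j k m l : Fin n) : curv G j k y m l = riemann G y j k l m := rfl

theorem curv_eq (j k : Fin n) : curv G j k y =
    mpd k (conn G j) y - mpd j (conn G k) y + (conn G k y * conn G j y - conn G j y * conn G k y) := by
  ext m l
  simp [curv, riemann, conn, Matrix.mul_apply]

theorem curv_antisymm (j k : Fin n) : curv G j k y = -curv G k j y := by
  rw [curv_eq, curv_eq]; abel

theorem riemannLow_eq (j k l m : Fin n) : riemannLow G y j k l m = (G y * curv G j k y) m l := by
  simp [riemannLow, Matrix.mul_apply, curv_apply]

theorem riemannLow_antisymm_left (j k l m : Fin n) :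
    riemannLow G y j k l m = -riemannLow G y k j l m := by
  rw [riemannLow_eq, riemannLow_eq, curv_antisymm j k, Matrix.mul_neg, Matrix.neg_apply]

namespace IsMetricOn

variable (hG : IsMetricOn G s)
include hG

theorem mem_nhds (hy : y ∈ s) : s ∈ 𝓝 y := hG.isOpen.mem_nhds hy

theorem isUnit_det (hy : y ∈ s) : IsUnit (G y).det := (hG.det_ne_zero y hy).isUnit

theorem symm_apply (hy : y ∈ s) (i j : Fin n) : G y i j = G y j i :=
  congrFun (congrFun (hG.symm y hy) j) i

theorem inv_symm_apply (hy : y ∈ s) (i j : Fin n) : (G y)⁻¹ i j = (G y)⁻¹ j i := by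
  have h : ((G y)⁻¹)ᵀ = (G y)⁻¹ := by rw [Matrix.transpose_nonsing_inv, hG.symm y hy]
  exact congrFun (congrFun h j) i

theorem smooth_inv (hy : y ∈ s) : MSmooth (fun z => (G z)⁻¹) y :=
  (hG.smooth y hy).inv (hG.det_ne_zero y hy)

theorem pd_symm (hy : y ∈ s) (p i j : Fin n) :
    pd p (fun z => G z i j) y = pd p (fun z => G z j i) y :=
  pd_congr (Filter.eventually_of_mem (hG.mem_nhds hy) fun _ hz => hG.symm_apply hz i j)

theorem christoffel_symm (hy : y ∈ s) (m i j : Fin n) :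
    christoffel G y m i j = christoffel G y m j i := by
  simp only [christoffel]
  congr 1
  refine Finset.sum_congr rfl fun p _ => ?_
  rw [hG.pd_symm hy p i j]
  ring

theorem smooth_christoffel (hy : y ∈ s) (m i j : Fin n) :
    ContDiffAt ℝ ∞ (fun z => christoffel G z m i j) y := by
  have h := fun i j p => smooth_pd (i := p) (hG.smooth y hy i j)
  exact contDiffAt_const.mul (smooth_sum fun p _ => (hG.smooth_inv hy m p).mul
    (((h j p i).add (h i p j)).sub (h i j p)))

theorem smooth_conn (hy : y ∈ s) (j : Fin n) : MSmooth (conn G j) y :=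
  fun m l => hG.smooth_christoffel hy m j l

theorem smooth_curv (hy : y ∈ s) (j k : Fin n) : MSmooth (curv G j k) y := by
  have h : curv G j k = fun z => mpd k (conn G j) z - mpd j (conn G k) z +
      (conn G k z * conn G j z - conn G j z * conn G k z) := funext fun z => curv_eq j k
  rw [h]
  have hc := hG.smooth_conn hy
  exact ((hc j).mpd.sub (hc k).mpd).add (((hc k).mul (hc j)).sub ((hc j).mul (hc k)))

theorem lower_conn (hy : y ∈ s) (k a l : Fin n) : (G y * conn G k y) a l =
    (1 / 2 : ℝ) * (pd k (fun z => G z l a) y + pd l (fun z => G z k a) y -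
      pd a (fun z => G z k l) y) := by
  set K : Matrix (Fin n) (Fin n) ℝ := Matrix.of fun p l =>
    (1 / 2 : ℝ) * (pd k (fun z => G z l p) y + pd l (fun z => G z k p) y -
      pd p (fun z => G z k l) y) with hK
  have h : conn G k y = (G y)⁻¹ * K := by
    ext m l
    rw [conn_apply, christoffel, Matrix.mul_apply, Finset.mul_sum]
    refine Finset.sum_congr rfl fun p _ => ?_
    simp only [hK, Matrix.of_apply]
    ring
  rw [h, Matrix.mul_nonsing_inv_cancel_left _ _ (hG.isUnit_det hy), hK, Matrix.of_apply]

/-- The Levi-Civita connection is metric. -/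
theorem mpd_metric (hy : y ∈ s) (k : Fin n) :
    mpd k G y = (conn G k y)ᵀ * G y + G y * conn G k y := by
  have h : (conn G k y)ᵀ * G y = (G y * conn G k y)ᵀ := by
    rw [Matrix.transpose_mul, hG.symm y hy]
  ext a b
  rw [h, Matrix.add_apply, Matrix.transpose_apply, hG.lower_conn hy, hG.lower_conn hy, mpd_apply,
    hG.pd_symm hy k b a]
  ring

/-- The Levi-Civita connection is the only symmetric metric connection. -/
theorem conn_unique (hy : y ∈ s) (A : Fin n → Matrix (Fin n) (Fin n) ℝ)
    (hA : ∀ j m l, A j m l = A l m j)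
    (hm : ∀ k, mpd k G y = (A k)ᵀ * G y + G y * A k) (k : Fin n) : A k = conn G k y := by
  have h1 : ∀ k a b, pd k (fun z => G z a b) y = (G y * A k) b a + (G y * A k) a b := by
    intro k a b
    have h := congrFun (congrFun (hm k) a) b
    have h2 : (A k)ᵀ * G y = (G y * A k)ᵀ := by
      rw [Matrix.transpose_mul, hG.symm y hy]
    rwa [h2] at h
  have h3 : ∀ a j l, (G y * A j) a l = (G y * A l) a j := by
    intro a j l
    simp only [Matrix.mul_apply, hA j _ l]
  -- Koszul's argument: in the alternating sum of three metric derivatives, the symmetry `h3`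
  -- cancels all but one lowered coefficient.
  have h4 : G y * A k = G y * conn G k y := by
    ext a l
    rw [hG.lower_conn hy, h1, h1, h1]
    linarith [h3 a k l, h3 k a l, h3 l k a]
  rw [← Matrix.nonsing_inv_mul_cancel_left (G y) (A k) (hG.isUnit_det hy), h4,
    Matrix.nonsing_inv_mul_cancel_left _ _ (hG.isUnit_det hy)]

/-- The mixed second derivatives of the metric agree. Substituting `mpd_metric` twice in them leaves
exactly the symmetric part of the lowered curvature. -/
theorem lower_curv_antisymm (hy : y ∈ s) (j k : Fin n) :
    (curv G j k y)ᵀ * G y + G y * curv G j k y = 0 := by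
  have hc := hG.smooth_conn hy
  have hs := hG.smooth y hy
  have h1 : ∀ j k, mpd k (mpd j G) y =
      (mpd k (conn G j) y)ᵀ * G y + (conn G j y)ᵀ * mpd k G y +
        (mpd k G y * conn G j y + G y * mpd k (conn G j) y) := by
    intro j k
    rw [mpd_congr (H := fun z => (conn G j z)ᵀ * G z + G z * conn G j z)
      (Filter.eventually_of_mem (hG.mem_nhds hy) fun z hz => hG.mpd_metric hz j),
      mpd_add ((hc j).transpose.mul hs) (hs.mul (hc j)), mpd_mul (hc j).transpose hs,
      mpd_mul hs (hc j), mpd_transpose]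
  have h2 := mpd_comm (i := k) (j := j) hs
  rw [h1, h1, hG.mpd_metric hy, hG.mpd_metric hy] at h2
  rw [curv_eq]
  simp only [Matrix.transpose_add, Matrix.transpose_sub, Matrix.transpose_mul]
  rw [← sub_eq_zero] at h2
  rw [← h2]
  noncomm_ring

/-- Symmetry of Γ in its lower indices makes both the derivative and the quadratic terms cancel in
the cyclic sum. -/
theorem bianchi_first (hy : y ∈ s) (j k l m : Fin n) :
    riemann G y j k l m + riemann G y k l j m + riemann G y l j k m = 0 := by
  have h1 : ∀ p m i j, pd p (fun z => christoffel G z m i j) y =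
      pd p (fun z => christoffel G z m j i) y := fun p m i j =>
    pd_congr (Filter.eventually_of_mem (hG.mem_nhds hy) fun z hz => hG.christoffel_symm hz m i j)
  simp only [riemann, Finset.sum_sub_distrib]
  rw [h1 k m j l, h1 l m k j, h1 j m l k]
  simp only [hG.christoffel_symm hy _ j l, hG.christoffel_symm hy _ k j,
    hG.christoffel_symm hy _ l k]
  ring

/-- The second Bianchi identity, in terms of the endomorphism valued curvature form. -/
theorem bianchi_second (hy : y ∈ s) (i j k : Fin n) :
    (mpd i (curv G j k) y + conn G i y * curv G j k y - curv G j k y * conn G i y) +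
    (mpd j (curv G k i) y + conn G j y * curv G k i y - curv G k i y * conn G j y) +
    (mpd k (curv G i j) y + conn G k y * curv G i j y - curv G i j y * conn G k y) = 0 := by
  have hc := hG.smooth_conn hy
  have h1 : ∀ i j k, mpd i (curv G j k) y = mpd i (mpd k (conn G j)) y - mpd i (mpd j (conn G k)) y +
      (mpd i (conn G k) y * conn G j y + conn G k y * mpd i (conn G j) y -
        (mpd i (conn G j) y * conn G k y + conn G j y * mpd i (conn G k) y)) := by
    intro i j k
    have h : curv G j k = fun z => mpd k (conn G j) z - mpd j (conn G k) z +
      (conn G k z * conn G j z - conn G j z * conn G k z) := funext fun z => curv_eq j k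
    rw [h, mpd_add ((hc j).mpd.sub (hc k).mpd) (((hc k).mul (hc j)).sub ((hc j).mul (hc k))),
      mpd_sub (hc j).mpd (hc k).mpd, mpd_sub ((hc k).mul (hc j)) ((hc j).mul (hc k)),
      mpd_mul (hc k) (hc j), mpd_mul (hc j) (hc k)]
  rw [h1, h1, h1, mpd_comm (i := j) (j := i) (hc k), mpd_comm (i := k) (j := i) (hc j),
    mpd_comm (i := k) (j := j) (hc i), curv_eq, curv_eq, curv_eq]
  noncomm_ring

/-! ### Symmetries of the lowered curvature tensor -/

theorem riemannLow_antisymm_right (hy : y ∈ s) (j k l m : Fin n) :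
    riemannLow G y j k l m = -riemannLow G y j k m l := by
  have h := congrFun (congrFun (hG.lower_curv_antisymm hy j k) l) m
  have h2 : (curv G j k y)ᵀ * G y = (G y * curv G j k y)ᵀ := by
    rw [Matrix.transpose_mul, hG.symm y hy]
  rw [h2, Matrix.add_apply, Matrix.transpose_apply, Matrix.zero_apply] at h
  rw [riemannLow_eq, riemannLow_eq]
  linarith

theorem riemannLow_cyclic (hy : y ∈ s) (j k l m : Fin n) :
    riemannLow G y j k l m + riemannLow G y k l j m + riemannLow G y l j k m = 0 := by
  simp only [riemannLow, ← Finset.sum_add_distrib, ← mul_add, hG.bianchi_first hy]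
  simp

/-- The classical octahedron argument: a combination of four cyclic identities, reduced by the two
antisymmetries. -/
theorem riemannLow_pair (hy : y ∈ s) (j k l m : Fin n) :
    riemannLow G y j k l m = riemannLow G y l m j k := by
  have a := hG.riemannLow_cyclic hy
  have b := riemannLow_antisymm_left (G := G) (y := y)
  have c := hG.riemannLow_antisymm_right hy
  linarith [a j k l m, a k l m j, a l m j k, a m j k l, b j k l m, b k l j m, b l j k m, b k l m j,
    b l m k j, b m k l j, b l m j k, b m j l k, b j l m k, b m j k l, b j k m l, b k m j l,
    c j k l m, c k l j m, c l j k m, c k l m j,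
    c l m k j, c m k l j, c l m j k, c m j l k, c j l m k, c m j k l, c j k m l, c k m j l]

end IsMetricOn

end LeviCivita

/-! ### Null bivectors in Lorentzian signature. -/

section Algebra

variable {n : ℕ}

/-- A bivector-valued Lorentzian identity in an orthonormal frame: an antisymmetric `S` of zero
square which annihilates the null covector `ξ` is divisible by `ξ`. -/
theorem antisymm_divisible_by_null (η : Fin n → ℝ) (o : Fin n) (hη : ∀ p, p ≠ o → η p = 1)
    (S : Matrix (Fin n) (Fin n) ℝ) (hS : ∀ p q, S p q = -S q p) (ξ : Fin n → ℝ)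
    (hnull : ∑ p, η p * ξ p ^ 2 = 0) (hξS : ∀ q, ∑ p, η p * ξ p * S p q = 0)
    (hSS : ∑ p, ∑ q, η p * η q * S p q ^ 2 = 0) (p q : Fin n) :
    ξ o * S p q = ξ p * S o q - ξ q * S o p := by
  -- `T p q` is the component of ξ ∧ S with one index equal to the time index `o`. It vanishes if
  -- `p` or `q` is `o`, so its η-norm is an honest sum of squares.
  set T : Fin n → Fin n → ℝ := fun p q => ξ o * S p q - ξ p * S o q + ξ q * S o p with hT
  have hSo : S o o = 0 := by linarith [hS o o]
  have hξS' : ∑ p, η p * ξ p * S o p = 0 := by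
    have := hξS o
    simp only [hS _ o, mul_neg, Finset.sum_neg_distrib] at this ⊢
    linarith
  -- Every term of the expanded norm contains one of the vanishing contractions: ξ with itself, ξ
  -- with S, or S with itself.
  have h0 : ∑ p, ∑ q, η p * η q * T p q ^ 2 = 0 := by
    have e1 : ∀ p q, η p * η q * T p q ^ 2 = ξ o ^ 2 * (η p * η q * S p q ^ 2) +
        (η p * ξ p ^ 2) * (η q * S o q ^ 2) + (η p * S o p ^ 2) * (η q * ξ q ^ 2)
        + (-2 * ξ o * η q * S o q) * (η p * ξ p * S p q) +
        (-2 * ξ o * η p * S o p) * (η q * ξ q * S q p) +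
        (-2) * ((η p * ξ p * S o p) * (η q * ξ q * S o q)) := by
      intro p q
      rw [hT, hS q p]
      ring
    have e2 : ∑ p, ∑ q, (-2 * ξ o * η q * S o q) * (η p * ξ p * S p q) = 0 := by
      rw [Finset.sum_comm]
      simp only [← Finset.mul_sum, hξS, mul_zero, Finset.sum_const_zero]
    simp only [e1, Finset.sum_add_distrib, e2]
    simp only [← Finset.mul_sum, ← Finset.sum_mul, hξS, hξS', hnull, hSS]
    simp
  have hTo : ∀ q, T o q = 0 := fun q => by simp only [hT]; rw [hSo]; ring
  have hTo' : ∀ p, T p o = 0 := fun p => by simp only [hT]; rw [hSo, hS p o]; ring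
  have h1 : ∀ p q, η p * η q * T p q ^ 2 = T p q ^ 2 := by
    intro p q
    by_cases hp : p = o
    · subst hp; simp [hTo]
    by_cases hq : q = o
    · subst hq; simp [hTo']
    rw [hη p hp, hη q hq]; ring
  simp only [h1] at h0
  have h2 := (Finset.sum_eq_zero_iff_of_nonneg fun p _ =>
    Finset.sum_nonneg fun q _ => sq_nonneg (T p q)).1 h0 p (Finset.mem_univ _)
  have h3 := (Finset.sum_eq_zero_iff_of_nonneg fun q _ => sq_nonneg (T p q)).1 h2 q
    (Finset.mem_univ _)
  have h4 : T p q = 0 := by simpa using h3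
  simp only [hT] at h4
  linarith

/-- The signature of a Lorentzian metric. -/
noncomputable def minkowski (n : ℕ) (i : Fin n) : ℝ := if (i : ℕ) = 0 then -1 else 1

theorem minkowski_mul_self : diagonal (minkowski n) * diagonal (minkowski n) = 1 := by
  rw [diagonal_mul_diagonal, ← diagonal_one]
  congr 1
  ext i
  unfold minkowski
  split_ifs <;> norm_num

/-- This is `antisymm_divisible_by_null` carried from the orthonormal frame `B⁻¹` to arbitrary
coordinates. The vector `u` is the timelike frame vector. It depends on ξ but not on `R`, so the
same `u` serves every index pair of the curvature, and serves twice. -/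
theorem exists_null_complement {G B : Matrix (Fin n) (Fin n) ℝ} (hdet : IsUnit G.det)
    (hGB : G = Bᵀ * diagonal (minkowski n) * B) {ξ : Fin n → ℝ} (hξ0 : ξ ≠ 0)
    (hnull : ξ ⬝ᵥ (G⁻¹ *ᵥ ξ) = 0) :
    ∃ u : Fin n → ℝ, ξ ⬝ᵥ u ≠ 0 ∧ ∀ R : Matrix (Fin n) (Fin n) ℝ, Rᵀ = -R →
      ξ ᵥ* (G⁻¹ * R) = 0 → (G⁻¹ * R * G⁻¹ * Rᵀ).trace = 0 →
      ∀ a b, (ξ ⬝ᵥ u) * R a b = ξ a * (u ᵥ* R) b - ξ b * (u ᵥ* R) a := by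
  have hB : IsUnit B.det := by
    rw [hGB, det_mul, det_mul] at hdet
    exact isUnit_of_mul_isUnit_right hdet
  set D := diagonal (minkowski n) with hD
  have hDD : D * D = 1 := minkowski_mul_self
  set E := B⁻¹ with hE
  have hEB : E * B = 1 := nonsing_inv_mul _ hB
  have hBE : B * E = 1 := mul_nonsing_inv _ hB
  have hBEt : Bᵀ * Eᵀ = 1 := by rw [← transpose_mul, hEB, transpose_one]
  have hGi : G⁻¹ = E * D * Eᵀ := by
    refine inv_eq_right_inv ?_
    rw [hGB]
    calc Bᵀ * D * B * (E * D * Eᵀ) = Bᵀ * D * (B * E) * D * Eᵀ := by simp only [Matrix.mul_assoc]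
      _ = Bᵀ * (D * D) * Eᵀ := by rw [hBE]; simp only [Matrix.mul_assoc, Matrix.mul_one]
      _ = 1 := by rw [hDD, Matrix.mul_one, hBEt]
  have hDv : ∀ v : Fin n → ℝ, ∀ p, (D *ᵥ v) p = minkowski n p * v p := fun v p => by
    rw [hD, mulVec_diagonal]
  set ζ : Fin n → ℝ := ξ ᵥ* E with hζ
  have hζB : ζ ᵥ* B = ξ := by rw [hζ, vecMul_vecMul, hEB, vecMul_one]
  have hζnull : ∑ p, minkowski n p * ζ p ^ 2 = 0 := by
    rw [hGi, Matrix.mul_assoc, ← mulVec_mulVec, ← mulVec_mulVec, dotProduct_mulVec,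
      mulVec_transpose, ← hζ] at hnull
    simp only [dotProduct, hDv] at hnull
    rw [← hnull]
    exact Finset.sum_congr rfl fun p _ => by ring
  have hn : 0 < n := by
    rcases Nat.eq_zero_or_pos n with rfl | h
    · exact absurd (Subsingleton.elim ξ 0) hξ0
    · exact h
  set o : Fin n := ⟨0, hn⟩ with ho
  have hηo : ∀ p, p ≠ o → minkowski n p = 1 := by
    intro p hp
    rw [minkowski, if_neg]
    exact fun h => hp (Fin.ext h)
  -- A null covector without time component has zero Euclidean norm, hence is zero.
  have hζo : ζ o ≠ 0 := by
    intro h0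
    apply hξ0
    have h1 : ∀ p, minkowski n p * ζ p ^ 2 = ζ p ^ 2 := by
      intro p
      by_cases hp : p = o
      · rw [hp, h0]; ring
      · rw [hηo p hp]; ring
    simp only [h1] at hζnull
    have h2 : ζ = 0 := by
      ext p
      have := (Finset.sum_eq_zero_iff_of_nonneg fun p _ => sq_nonneg (ζ p)).1 hζnull p
        (Finset.mem_univ _)
      simpa using this
    rw [← hζB, h2, zero_vecMul]
  have hζu : ξ ⬝ᵥ (fun i => E i o) = ζ o := rfl
  refine ⟨fun i => E i o, by rwa [hζu], fun R hR hξR htr a b => ?_⟩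
  set S := Eᵀ * R * E with hSdef
  have hRS : R = Bᵀ * S * B := by
    calc R = (Bᵀ * Eᵀ) * R * (E * B) := by rw [hBEt, hEB, Matrix.one_mul, Matrix.mul_one]
      _ = Bᵀ * S * B := by rw [hSdef]; simp only [Matrix.mul_assoc]
  have hSt : Sᵀ = -S := by
    rw [hSdef]
    simp only [transpose_mul, transpose_transpose, hR, Matrix.neg_mul, Matrix.mul_neg,
      Matrix.mul_assoc]
  have hSa : ∀ p q, S p q = -S q p := fun p q => by
    have := congrFun (congrFun hSt q) p
    simpa using this
  have hζS : ∀ q, ∑ p, minkowski n p * ζ p * S p q = 0 := by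
    have h1 : (ζ ᵥ* D) ᵥ* S = 0 := by
      rw [hζ, hSdef, vecMul_vecMul, vecMul_vecMul]
      have : E * D * (Eᵀ * R * E) = G⁻¹ * R * E := by rw [hGi]; simp only [Matrix.mul_assoc]
      rw [← Matrix.mul_assoc, this, ← vecMul_vecMul, hξR, zero_vecMul]
    intro q
    have h2 := congrFun h1 q
    simp only [vecMul, dotProduct, hD] at h2
    rw [Pi.zero_apply] at h2
    rw [← h2]
    refine Finset.sum_congr rfl fun p _ => ?_
    simp [diagonal_apply, mul_comm]
  have hSS : ∑ p, ∑ q, minkowski n p * minkowski n q * S p q ^ 2 = 0 := by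
    have h1 : (G⁻¹ * R * G⁻¹ * Rᵀ).trace = (D * S * (D * Sᵀ)).trace := by
      have e1 : G⁻¹ * R * G⁻¹ * Rᵀ = E * (D * Eᵀ * R * E * D * Eᵀ * Rᵀ) := by
        rw [hGi]; simp only [Matrix.mul_assoc]
      rw [e1, trace_mul_comm, hSdef]
      simp only [transpose_mul, transpose_transpose, Matrix.mul_assoc]
    rw [h1, trace] at htr
    rw [← htr]
    refine Finset.sum_congr rfl fun p _ => ?_
    rw [diag_apply, mul_apply]
    refine Finset.sum_congr rfl fun q _ => ?_
    rw [hD, diagonal_mul, diagonal_mul, transpose_apply]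
    ring
  have key := antisymm_divisible_by_null (minkowski n) o hηo S hSa ζ hζnull hζS hSS
  have hu : ∀ c, ((fun i => E i o) ᵥ* R) c = ∑ q, S o q * B q c := by
    intro c
    have h1 : ((fun i => E i o) ᵥ* R) c = (Eᵀ * R) o c := rfl
    have h2 : Eᵀ * R = S * B := by
      rw [hSdef, Matrix.mul_assoc, hEB, Matrix.mul_one]
    rw [h1, h2, mul_apply]
  have hξc : ∀ c, ξ c = ∑ p, ζ p * B p c := fun c => (congrFun hζB c).symm
  have hRab : R a b = ∑ p, ∑ q, B p a * S p q * B q b := by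
    conv_lhs => rw [hRS]
    rw [mul_apply]
    simp only [mul_apply, Finset.sum_mul, transpose_apply]
    exact Finset.sum_comm
  rw [hζu, hRab, hu, hu, hξc a, hξc b, Finset.sum_mul_sum, Finset.sum_mul_sum,
    Finset.sum_comm (s := Finset.univ) (t := Finset.univ) (f := fun i j => ζ i * B i b * _),
    ← Finset.sum_sub_distrib, Finset.mul_sum]
  refine Finset.sum_congr rfl fun p _ => ?_
  rw [← Finset.sum_sub_distrib, Finset.mul_sum]
  refine Finset.sum_congr rfl fun q _ => ?_
  linear_combination B p a * B q b * key p q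

end Algebra

/-- `ξ` is the coordinate expression of a parallel, nowhere zero, null 1-form. -/
structure IsParallelNullOn {n : ℕ} (G : Coord n → Matrix (Fin n) (Fin n) ℝ)
    (ξ : Coord n → Fin n → ℝ) (s : Set (Coord n)) : Prop where
  smooth : ∀ y ∈ s, ∀ i, ContDiffAt ℝ ∞ (fun z => ξ z i) y
  parallel : ∀ y ∈ s, ∀ j k, pd j (fun z => ξ z k) y = ∑ m, christoffel G y m j k * ξ y m
  null : ∀ y ∈ s, ξ y ⬝ᵥ ((G y)⁻¹ *ᵥ ξ y) = 0
  ne_zero : ∀ y ∈ s, ξ y ≠ 0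

/-! ### Curvature in the presence of a parallel null 1-form. -/

section Parallel

variable {n : ℕ} {G : Coord n → Matrix (Fin n) (Fin n) ℝ} {s : Set (Coord n)} {y : Coord n}
  {ξ : Coord n → Fin n → ℝ}

namespace IsMetricOn

variable (hG : IsMetricOn G s) (hξ : IsParallelNullOn G ξ s)
include hG hξ

/-- Integrability condition of ∇ξ = 0: differentiating the equation once more expresses ∂_i∂_jξ
through Γ, and its antisymmetric part is ξ applied to the curvature. -/
theorem vecMul_curv (hy : y ∈ s) (i j : Fin n) : ξ y ᵥ* curv G i j y = 0 := by
  have hc := hG.smooth_conn hy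
  have h1 : ∀ i j k, pd i (pd j (fun z => ξ z k)) y =
      (ξ y ᵥ* (mpd i (conn G j) y + conn G i y * conn G j y)) k := by
    intro i j k
    rw [pd_congr (h := fun z => ∑ m, christoffel G z m j k * ξ z m)
      (Filter.eventually_of_mem (hG.mem_nhds hy) fun z hz => hξ.parallel z hz j k),
      pd_sum (F := fun m z => christoffel G z m j k * ξ z m) fun m _ => ((hc j).differentiableAt m k).fun_mul
        (differentiableAt_of_smooth (hξ.smooth y hy m)), vecMul_add, ← vecMul_vecMul, Pi.add_apply]
    simp only [vecMul, dotProduct]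
    rw [← Finset.sum_add_distrib]
    refine Finset.sum_congr rfl fun m _ => ?_
    rw [pd_mul (f := fun z => christoffel G z m j k) ((hc j).differentiableAt m k) (differentiableAt_of_smooth (hξ.smooth y hy m)),
      hξ.parallel y hy, mpd_apply]
    simp only [conn_apply]
    rw [mul_comm, mul_comm (christoffel G y m j k)]
    simp only [mul_comm (ξ y _)]
  have h2 : curv G i j y = (mpd j (conn G i) y + conn G j y * conn G i y) -
      (mpd i (conn G j) y + conn G i y * conn G j y) := by rw [curv_eq]; abel
  ext k
  rw [h2, vecMul_sub, Pi.sub_apply, ← h1, ← h1, pd_comm (hξ.smooth y hy k)]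
  simp

theorem riemannLow_null (hy : y ∈ s) (i j k : Fin n) :
    ∑ m, (ξ y ᵥ* (G y)⁻¹) m * riemannLow G y i j k m = 0 := by
  have h := congrFun (hG.vecMul_curv hξ hy i j) k
  have h2 : curv G i j y = (G y)⁻¹ * (G y * curv G i j y) := by
    rw [nonsing_inv_mul_cancel_left _ _ (hG.isUnit_det hy)]
  rw [h2, ← vecMul_vecMul] at h
  simp only [riemannLow_eq]
  exact h

omit hξ in
theorem ricci_eq (hy : y ∈ s) (k l : Fin n) :
    ricci G y k l = -∑ p, ∑ a, (G y)⁻¹ p a * riemannLow G y p k l a := by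
  rw [ricci]
  congr 1
  refine Finset.sum_congr rfl fun p _ => ?_
  have h2 : curv G p k y = (G y)⁻¹ * (G y * curv G p k y) := by
    rw [nonsing_inv_mul_cancel_left _ _ (hG.isUnit_det hy)]
  rw [← curv_apply, h2, mul_apply]
  simp only [riemannLow_eq]

/-- The Ricci tensor of a pp-wave is a multiple of the square of the parallel null 1-form. -/
theorem exists_ricci_eq (hB : ∃ B : Matrix (Fin n) (Fin n) ℝ,
      G y = Bᵀ * diagonal (minkowski n) * B)
    (hpp : ∀ j k l m, ∑ p, ∑ q, ∑ a, ∑ b, (G y)⁻¹ p a * (G y)⁻¹ q b *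
      riemannLow G y j k a b * riemannLow G y p q l m = 0) (hy : y ∈ s) :
    ∃ ψ : ℝ, ∀ k l, ricci G y k l = ψ * (ξ y k * ξ y l) := by
  obtain ⟨B, hB⟩ := hB
  have hasym := hG.riemannLow_antisymm_right hy
  have hpair := hG.riemannLow_pair hy
  have hnull := hG.riemannLow_null hξ hy
  obtain ⟨u, hu, hR⟩ := exists_null_complement (hG.isUnit_det hy) hB (hξ.ne_zero y hy)
    (hξ.null y hy)
  set t := ξ y ⬝ᵥ u with ht
  set x := ξ y ᵥ* (G y)⁻¹ with hx
  have h1 : ∀ j k a b, t * riemannLow G y j k a b =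
      ξ y a * (∑ i, u i * riemannLow G y j k i b) - ξ y b * (∑ i, u i * riemannLow G y j k i a) := by
    intro j k a b
    refine hR (Matrix.of fun a b => riemannLow G y j k a b) ?_ ?_ ?_ a b
    · ext c d
      exact hasym j k d c
    · ext c
      rw [← vecMul_vecMul, ← hx]
      simp only [vecMul, dotProduct, of_apply, Pi.zero_apply]
      rw [← neg_eq_zero, ← Finset.sum_neg_distrib, ← hnull j k c]
      refine Finset.sum_congr rfl fun m _ => ?_
      rw [hasym j k m c]; ring
    -- With (l, m) = (j, k), pair symmetry turns the pp-wave condition into the vanishing of the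
    -- norm of R_{jk··}.
    · have h := hpp j k j k
      rw [← h, trace]
      refine Finset.sum_congr rfl fun p _ => ?_
      rw [diag_apply, mul_apply]
      refine Finset.sum_congr rfl fun q _ => ?_
      rw [mul_apply, Finset.sum_mul]
      simp only [mul_apply, Finset.sum_mul, transpose_apply, of_apply]
      rw [Finset.sum_comm]
      refine Finset.sum_congr rfl fun a _ => Finset.sum_congr rfl fun b _ => ?_
      rw [hpair p q j k, hG.inv_symm_apply hy b q]; ring
  -- The curvature contracted with `u` once in each pair. It is the symmetric tensor left over after
  -- ξ has been divided out of both pairs.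
  set z : Fin n → Fin n → ℝ := fun b k => ∑ i, u i * ∑ l, u l * riemannLow G y i b l k with hz
  -- Pair symmetry exchanges the two index pairs, so the same division applies to the first pair.
  have h2 : ∀ j k b, t * (∑ i, u i * riemannLow G y j k i b) = ξ y j * z b k - ξ y k * z b j := by
    intro j k b
    simp only [hz, Finset.mul_sum, ← Finset.sum_sub_distrib]
    refine Finset.sum_congr rfl fun i _ => ?_
    have h := h1 i b j k
    rw [hpair j k i b]
    calc t * (u i * riemannLow G y i b j k) = u i * (t * riemannLow G y i b j k) := by ring
      _ = _ := by
        rw [h, mul_sub]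
        simp only [Finset.mul_sum, ← Finset.sum_sub_distrib]
        exact Finset.sum_congr rfl fun l _ => by ring
  have h3 : ∀ j k a b, t ^ 2 * riemannLow G y j k a b =
      ξ y a * (ξ y j * z b k - ξ y k * z b j) - ξ y b * (ξ y j * z a k - ξ y k * z a j) := by
    intro j k a b
    rw [← h2, ← h2]
    linear_combination t * h1 j k a b
  have hxz : ∀ k, ∑ b, x b * z k b = 0 := by
    intro k
    simp only [hz, Finset.mul_sum]
    rw [Finset.sum_comm]
    refine Finset.sum_eq_zero fun i _ => ?_
    rw [Finset.sum_comm]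
    refine Finset.sum_eq_zero fun l _ => ?_
    calc ∑ b, x b * (u i * (u l * riemannLow G y i k l b))
        = u i * u l * ∑ b, x b * riemannLow G y i k l b := by
          rw [Finset.mul_sum]; exact Finset.sum_congr rfl fun b _ => by ring
      _ = 0 := by rw [hnull, mul_zero]
  have hzs : ∀ b k, z b k = z k b := by
    intro b k
    simp only [hz, Finset.mul_sum]
    rw [Finset.sum_comm]
    refine Finset.sum_congr rfl fun i _ => Finset.sum_congr rfl fun l _ => ?_
    rw [hpair]; ring
  have hxa : ∀ a, ∑ p, (G y)⁻¹ p a * ξ y p = x a := fun a => by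
    simp only [hx, vecMul, dotProduct, mul_comm]
  have hxp : ∀ p, ∑ a, (G y)⁻¹ p a * ξ y a = x p := fun p => by
    rw [← hxa]; exact Finset.sum_congr rfl fun a _ => by rw [hG.inv_symm_apply hy]
  have hxξ : ∑ p, x p * ξ y p = 0 := by
    have h := hξ.null y hy
    rw [dotProduct_mulVec] at h
    exact h
  -- Tracing `h3`, each term in which ξ is contracted with ξ or with `z` vanishes. Only the trace of
  -- `z` survives, as coefficient of ξ_k ξ_l.
  refine ⟨(∑ p, ∑ a, (G y)⁻¹ p a * z a p) / t ^ 2, fun k l => ?_⟩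
  have h4 : t ^ 2 * ricci G y k l = (∑ p, ∑ a, (G y)⁻¹ p a * z a p) * (ξ y k * ξ y l) := by
    have e1 : ∑ p, ∑ a, (G y)⁻¹ p a * ξ y p * z a k = 0 := by
      rw [Finset.sum_comm]
      simp only [← Finset.sum_mul, hxa, hzs _ k, hxz]
    have e2 : ∑ p, ∑ a, ((G y)⁻¹ p a * ξ y a) * ξ y p = 0 := by
      simp only [← Finset.sum_mul, hxp, hxξ]
    have e3 : ∑ p, ∑ a, ((G y)⁻¹ p a * ξ y a) * z l p = 0 := by
      simp only [← Finset.sum_mul, hxp, hxz]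
    have e4 : ∀ p a, (G y)⁻¹ p a * (t ^ 2 * riemannLow G y p k l a) =
        ξ y l * ((G y)⁻¹ p a * ξ y p * z a k) + (-(ξ y k * ξ y l)) * ((G y)⁻¹ p a * z a p) +
        (-z l k) * (((G y)⁻¹ p a * ξ y a) * ξ y p) +
        ξ y k * (((G y)⁻¹ p a * ξ y a) * z l p) := by
      intro p a; rw [h3]; ring
    rw [hG.ricci_eq hy]
    calc t ^ 2 * -∑ p, ∑ a, (G y)⁻¹ p a * riemannLow G y p k l a
        = -∑ p, ∑ a, (G y)⁻¹ p a * (t ^ 2 * riemannLow G y p k l a) := by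
          rw [mul_neg, Finset.mul_sum]
          congr 1
          refine Finset.sum_congr rfl fun p _ => ?_
          rw [Finset.mul_sum]
          exact Finset.sum_congr rfl fun a _ => by ring
      _ = _ := by
        simp only [e4, Finset.sum_add_distrib, ← Finset.mul_sum, e1, e2, e3]
        ring
  field_simp
  linarith

end IsMetricOn

end Parallel

/-! ### Rearrangement of multiple sums. -/

section Sums

variable {ι κ μ : Type*} [Fintype ι] [Fintype κ] [Fintype μ]

theorem sum_rotate (K : ι → κ → μ → ℝ) :
    ∑ j, ∑ l, ∑ m, K j l m = ∑ m, ∑ j, ∑ l, K j l m :=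
  (Finset.sum_congr rfl fun _ _ => Finset.sum_comm).trans Finset.sum_comm

/-- Moves a Christoffel correction on an uncontracted index out of a metric contraction. -/
theorem sum_mul_sum_left_comm (w : ι → κ → ℝ) (c : μ → ℝ) (f : μ → ι → κ → ℝ) :
    ∑ j, ∑ l, w j l * ∑ a, c a * f a j l = ∑ a, c a * ∑ j, ∑ l, w j l * f a j l := by
  simp only [Finset.mul_sum]
  rw [sum_rotate]
  simp only [mul_left_comm]

end Sums

/-! ### Explicit covariant derivatives of low rank and their compatibility with the metric. -/

section CovariantDerivatives

variable {n : ℕ}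

/-- The covariant derivative of a 2-tensor, `∇_j T_{kl}`. -/
noncomputable def nabla2 (G : Coord n → Matrix (Fin n) (Fin n) ℝ)
    (T : Coord n → Fin n → Fin n → ℝ) (y : Coord n) (j k l : Fin n) : ℝ :=
  pd j (fun z => T z k l) y - ∑ m, christoffel G y m j k * T y m l -
    ∑ m, christoffel G y m j l * T y k m

/-- The covariant derivative of a 3-tensor, `∇_p T_{jkl}`. -/
noncomputable def nabla3 (G : Coord n → Matrix (Fin n) (Fin n) ℝ)
    (T : Coord n → Fin n → Fin n → Fin n → ℝ) (y : Coord n) (p j k l : Fin n) : ℝ :=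
  pd p (fun z => T z j k l) y - ∑ m, christoffel G y m p j * T y m k l -
    ∑ m, christoffel G y m p k * T y j m l - ∑ m, christoffel G y m p l * T y j k m

/-- The covariant derivative of a 4-tensor, `∇_q T_{jklm}`. -/
noncomputable def nabla4 (G : Coord n → Matrix (Fin n) (Fin n) ℝ)
    (T : Coord n → Fin n → Fin n → Fin n → Fin n → ℝ) (y : Coord n) (q j k l m : Fin n) : ℝ :=
  pd q (fun z => T z j k l m) y - ∑ a, christoffel G y a q j * T y a k l m -
    ∑ a, christoffel G y a q k * T y j a l m - ∑ a, christoffel G y a q l * T y j k a m -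
    ∑ a, christoffel G y a q m * T y j k l a

/-- The covariant derivative of a 5-tensor, `∇_p T_{qjklm}`. -/
noncomputable def nabla5 (G : Coord n → Matrix (Fin n) (Fin n) ℝ)
    (T : Coord n → Fin n → Fin n → Fin n → Fin n → Fin n → ℝ) (y : Coord n)
    (p q j k l m : Fin n) : ℝ :=
  pd p (fun z => T z q j k l m) y - ∑ a, christoffel G y a p q * T y a j k l m -
    ∑ a, christoffel G y a p j * T y q a k l m - ∑ a, christoffel G y a p k * T y q j a l m -
    ∑ a, christoffel G y a p l * T y q j k a m - ∑ a, christoffel G y a p m * T y q j k l a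

variable {G : Coord n → Matrix (Fin n) (Fin n) ℝ}

theorem covD_two (T : Coord n → Fin n → Fin n → ℝ) :
    covD G (fun z (a : Fin 2 → Fin n) => T z (a 0) (a 1)) =
      fun z a => nabla2 G T z (a 0) (a 1) (a 2) := by
  funext z a
  simp [covD, nabla2, Fin.sum_univ_succ, Fin.tail, Function.update]
  ring

theorem covD_three (T : Coord n → Fin n → Fin n → Fin n → ℝ) :
    covD G (fun z (a : Fin 3 → Fin n) => T z (a 0) (a 1) (a 2)) =
      fun z a => nabla3 G T z (a 0) (a 1) (a 2) (a 3) := by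
  funext z a
  rw [covD, Fin.sum_univ_three]
  -- The tails and updates of index tuples reduce definitionally at numeral positions, so only the
  -- grouping of the subtractions has to be proved.
  have h : ∀ A B C D : ℝ, A - (B + C + D) = A - B - C - D := by
    intros; ring
  exact h _ _ _ _

theorem covD_four (T : Coord n → Fin n → Fin n → Fin n → Fin n → ℝ) :
    covD G (fun z (a : Fin 4 → Fin n) => T z (a 0) (a 1) (a 2) (a 3)) =
      fun z a => nabla4 G T z (a 0) (a 1) (a 2) (a 3) (a 4) := by
  funext z a
  rw [covD, Fin.sum_univ_four]
  have h : ∀ A B C D E : ℝ, A - (B + C + D + E) = A - B - C - D - E := by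
    intros; ring
  exact h _ _ _ _ _

theorem covD_five (T : Coord n → Fin n → Fin n → Fin n → Fin n → Fin n → ℝ) :
    covD G (fun z (a : Fin 5 → Fin n) => T z (a 0) (a 1) (a 2) (a 3) (a 4)) =
      fun z a => nabla5 G T z (a 0) (a 1) (a 2) (a 3) (a 4) (a 5) := by
  funext z a
  rw [covD, Fin.sum_univ_five]
  have h : ∀ A B C D E F : ℝ, A - (B + C + D + E + F) = A - B - C - D - E - F := by
    intros; ring
  exact h _ _ _ _ _ _

theorem covRicci_eq (y : Coord n) (j k l : Fin n) :
    covRicci G y j k l = nabla2 G (ricci G) y j k l := by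
  rw [covRicci, covD_two]; rfl

theorem covCovRicci_eq (y : Coord n) (i j k l : Fin n) :
    covCovRicci G y i j k l = nabla3 G (nabla2 G (ricci G)) y i j k l := by
  rw [covCovRicci, covD_two, covD_three]; rfl

theorem covCovWeyl_eq (y : Coord n) (p q j k l m : Fin n) :
    covCovWeyl G y p q j k l m = nabla5 G (nabla4 G (weyl G)) y p q j k l m := by
  rw [covCovWeyl, covD_four, covD_five]; rfl

theorem covD_one_apply (T : Coord n → Fin n → ℝ) (y : Coord n) (j k : Fin n) :
    covD G (fun z (a : Fin 1 → Fin n) => T z (a 0)) y ![j, k] =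
      pd j (fun z => T z k) y - ∑ m, christoffel G y m j k * T y m := by
  simp [covD, Fin.tail]

variable {y : Coord n}

theorem nabla2_congr {T T' : Coord n → Fin n → Fin n → ℝ} (h : T =ᶠ[𝓝 y] T') :
    nabla2 G T y = nabla2 G T' y := by
  funext j k l
  rw [nabla2, nabla2, h.eq_of_nhds, pd_congr (h.mono fun z hz => by rw [hz])]

theorem nabla3_congr {T T' : Coord n → Fin n → Fin n → Fin n → ℝ} (h : T =ᶠ[𝓝 y] T') :
    nabla3 G T y = nabla3 G T' y := by
  funext p j k l
  rw [nabla3, nabla3, h.eq_of_nhds, pd_congr (h.mono fun z hz => by rw [hz])]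

theorem nabla4_congr {T T' : Coord n → Fin n → Fin n → Fin n → Fin n → ℝ} (h : T =ᶠ[𝓝 y] T') :
    nabla4 G T y = nabla4 G T' y := by
  funext q j k l m
  rw [nabla4, nabla4, h.eq_of_nhds, pd_congr (h.mono fun z hz => by rw [hz])]

theorem nabla4_add {T T' : Coord n → Fin n → Fin n → Fin n → Fin n → ℝ}
    (hT : ∀ j k l m, ContDiffAt ℝ ∞ (fun z => T z j k l m) y)
    (hT' : ∀ j k l m, ContDiffAt ℝ ∞ (fun z => T' z j k l m) y) (q j k l m : Fin n) :
    nabla4 G (fun z j k l m => T z j k l m + T' z j k l m) y q j k l m =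
      nabla4 G T y q j k l m + nabla4 G T' y q j k l m := by
  simp only [nabla4, mul_add, Finset.sum_add_distrib]
  rw [pd_add (differentiableAt_of_smooth (hT j k l m)) (differentiableAt_of_smooth (hT' j k l m))]
  ring

theorem nabla4_const_mul {T : Coord n → Fin n → Fin n → Fin n → Fin n → ℝ} (c : ℝ)
    (hT : ∀ j k l m, ContDiffAt ℝ ∞ (fun z => T z j k l m) y) (q j k l m : Fin n) :
    nabla4 G (fun z j k l m => c * T z j k l m) y q j k l m = c * nabla4 G T y q j k l m := by
  simp only [nabla4, mul_left_comm _ c, ← Finset.mul_sum]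
  rw [pd_const_mul c (differentiableAt_of_smooth (hT j k l m))]
  ring

variable {s : Set (Coord n)}

namespace IsMetricOn

variable (hG : IsMetricOn G s)
include hG

theorem pd_metric (hy : y ∈ s) (q j m : Fin n) : pd q (fun z => G z j m) y =
    ∑ a, christoffel G y a q j * G y a m + ∑ a, christoffel G y a q m * G y j a := by
  have h := congrFun (congrFun (hG.mpd_metric hy q) j) m
  simp only [mpd_apply, Matrix.add_apply, Matrix.mul_apply, Matrix.transpose_apply, conn_apply] at h
  rw [h]
  congr 1
  exact Finset.sum_congr rfl fun a _ => mul_comm _ _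

/-- This is ∇g⁻¹ = 0, obtained by differentiating `G * G⁻¹ = 1` and using ∇g = 0. -/
theorem pd_inv (hy : y ∈ s) (p m q : Fin n) : pd p (fun z => (G z)⁻¹ m q) y =
    -(∑ a, christoffel G y m p a * (G y)⁻¹ a q) - ∑ a, christoffel G y q p a * (G y)⁻¹ m a := by
  have h1 : mpd p (fun z => G z * (G z)⁻¹) y = 0 := by
    rw [mpd_congr (H := fun _ => 1) (Filter.eventually_of_mem (hG.mem_nhds hy)
      fun z hz => mul_nonsing_inv _ (hG.isUnit_det hz))]
    ext a b
    exact pd_const _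
  rw [mpd_mul (hG.smooth y hy) (hG.smooth_inv hy), hG.mpd_metric hy] at h1
  have h2 : mpd p (fun z => (G z)⁻¹) y =
      -(conn G p y * (G y)⁻¹) - (G y)⁻¹ * (conn G p y)ᵀ := by
    have h3 := congrArg (fun K => (G y)⁻¹ * K) h1
    simp only [Matrix.mul_zero, Matrix.mul_add, Matrix.add_mul, Matrix.mul_assoc,
      mul_nonsing_inv _ (hG.isUnit_det hy), Matrix.mul_one,
      nonsing_inv_mul_cancel_left _ _ (hG.isUnit_det hy)] at h3
    rw [← sub_eq_zero, ← h3]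
    abel
  have h := congrFun (congrFun h2 m) q
  simp only [mpd_apply, Matrix.sub_apply, Matrix.neg_apply, Matrix.mul_apply, Matrix.transpose_apply, conn_apply] at h
  rw [h]
  congr 1
  exact Finset.sum_congr rfl fun a _ => mul_comm _ _

/-- Contraction with the inverse metric commutes with covariant differentiation. -/
theorem contract_nabla (hy : y ∈ s) {S : Coord n → Fin n → Fin n → ℝ}
    (hS : ∀ m q, ContDiffAt ℝ ∞ (fun z => S z m q) y) (p : Fin n) :
    ∑ m, ∑ q, (G y)⁻¹ m q * nabla2 G S y p m q = pd p (fun z => ∑ m, ∑ q, (G z)⁻¹ m q * S z m q) y := by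
  have hd := fun m q => (hG.smooth_inv hy).differentiableAt m q
  have hSd := fun m q => differentiableAt_of_smooth (hS m q)
  rw [pd_sum (F := fun m z => ∑ q, (G z)⁻¹ m q * S z m q)
    fun m _ => DifferentiableAt.fun_sum fun q _ => (hd m q).fun_mul (hSd m q)]
  have e1 : ∀ m, pd p (fun z => ∑ q, (G z)⁻¹ m q * S z m q) y =
      ∑ q, (pd p (fun z => (G z)⁻¹ m q) y * S y m q + (G y)⁻¹ m q * pd p (fun z => S z m q) y) := by
    intro m
    rw [pd_sum (F := fun q z => (G z)⁻¹ m q * S z m q) fun q _ => (hd m q).fun_mul (hSd m q)]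
    exact Finset.sum_congr rfl fun q _ => pd_mul (hd m q) (hSd m q)
  simp only [e1, hG.pd_inv hy, nabla2, mul_sub, sub_mul, neg_mul, Finset.sum_add_distrib,
    Finset.sum_sub_distrib, Finset.sum_neg_distrib, Finset.mul_sum, Finset.sum_mul]
  -- Renaming dummy indices matches the Γ-terms of `S` with those from ∂g⁻¹, and they cancel.
  have e2 : ∑ m, ∑ q, ∑ a, (G y)⁻¹ m q * (christoffel G y a p m * S y a q) =
      ∑ m, ∑ q, ∑ a, christoffel G y m p a * (G y)⁻¹ a q * S y m q := by
    have h : ∀ f : Fin n → Fin n → Fin n → ℝ, ∑ m, ∑ q, ∑ a, f m q a = ∑ m, ∑ q, ∑ a, f a q m := by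
      intro f
      rw [Finset.sum_comm]
      conv_rhs => rw [Finset.sum_comm]
      exact Finset.sum_congr rfl fun q _ => Finset.sum_comm
    rw [h]
    exact Finset.sum_congr rfl fun m _ => Finset.sum_congr rfl fun q _ =>
      Finset.sum_congr rfl fun a _ => by ring
  have e3 : ∑ m, ∑ q, ∑ a, (G y)⁻¹ m q * (christoffel G y a p q * S y m a) =
      ∑ m, ∑ q, ∑ a, christoffel G y q p a * (G y)⁻¹ m a * S y m q := by
    refine Finset.sum_congr rfl fun m _ => ?_
    rw [Finset.sum_comm]
    exact Finset.sum_congr rfl fun q _ => Finset.sum_congr rfl fun a _ => by ring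
  rw [e2, e3]
  ring

/-- Leibniz rule with ∇g = 0. It covers one of the four metric-times-Ricci terms of the Weyl tensor;
the index swaps below yield the others. -/
theorem nabla4_metric_mul (hy : y ∈ s) {T : Coord n → Fin n → Fin n → ℝ}
    (hT : ∀ k l, ContDiffAt ℝ ∞ (fun z => T z k l) y) (q j k l m : Fin n) :
    nabla4 G (fun z j k l m => G z j m * T z k l) y q j k l m = G y j m * nabla2 G T y q k l := by
  simp only [nabla4, nabla2]
  rw [pd_mul ((hG.smooth y hy).differentiableAt j m) (differentiableAt_of_smooth (hT k l)),
    hG.pd_metric hy]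
  simp only [mul_left_comm _ (G y j m), ← mul_assoc, ← Finset.sum_mul]
  simp only [mul_assoc (G y j m), ← Finset.mul_sum]
  ring

omit hG in
theorem nabla4_swap_left (T : Coord n → Fin n → Fin n → Fin n → Fin n → ℝ) (q j k l m : Fin n) :
    nabla4 G (fun z j k l m => T z k j l m) y q j k l m = nabla4 G T y q k j l m := by
  simp only [nabla4]; ring

omit hG in
theorem nabla4_swap_right (T : Coord n → Fin n → Fin n → Fin n → Fin n → ℝ) (q j k l m : Fin n) :
    nabla4 G (fun z j k l m => T z j k m l) y q j k l m = nabla4 G T y q j k m l := by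
  simp only [nabla4]; ring

theorem inv_mul_apply (hy : y ∈ s) (m b : Fin n) :
    ∑ q, (G y)⁻¹ m q * G y q b = if m = b then 1 else 0 := by
  have h := congrFun (congrFun (nonsing_inv_mul (G y) (hG.isUnit_det hy)) m) b
  rwa [mul_apply, one_apply] at h

end IsMetricOn

end CovariantDerivatives

/-- The Hessian `∇_i ∇_j f` of a function. -/
noncomputable def hessian {n : ℕ} (G : Coord n → Matrix (Fin n) (Fin n) ℝ) (f : Coord n → ℝ)
    (y : Coord n) (i j : Fin n) : ℝ :=
  pd i (pd j f) y - ∑ m, christoffel G y m i j * pd m f y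

/-- The covariant derivative of the endomorphism valued curvature form, `∇_q R_{jk}`. -/
noncomputable def nablaCurv {n : ℕ} (G : Coord n → Matrix (Fin n) (Fin n) ℝ) (y : Coord n)
    (q j k : Fin n) : Matrix (Fin n) (Fin n) ℝ :=
  mpd q (curv G j k) y + conn G q y * curv G j k y - curv G j k y * conn G q y -
    ∑ a, christoffel G y a q j • curv G a k y - ∑ a, christoffel G y a q k • curv G j a y

/-! ### The differential and contracted Bianchi identities. -/

section Curvature

variable {n : ℕ} {G : Coord n → Matrix (Fin n) (Fin n) ℝ} {s : Set (Coord n)} {y : Coord n}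

namespace IsMetricOn

variable (hG : IsMetricOn G s)
include hG

theorem smooth_riemannLow (hy : y ∈ s) (j k l m : Fin n) :
    ContDiffAt ℝ ∞ (fun z => riemannLow G z j k l m) y :=
  smooth_sum fun p _ => (hG.smooth y hy m p).mul (hG.smooth_curv hy j k p l)

theorem smooth_ricci (hy : y ∈ s) (k l : Fin n) : ContDiffAt ℝ ∞ (fun z => ricci G z k l) y :=
  (smooth_sum fun p _ => hG.smooth_curv hy p k p l).neg

omit hG in
theorem nablaCurv_antisymm (q j k : Fin n) : nablaCurv G y q j k = -nablaCurv G y q k j := by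
  have h : mpd q (curv G j k) y = -mpd q (curv G k j) y := by
    ext a b
    have : ∀ z, curv G j k z a b = -curv G k j z a b := fun z => by
      rw [curv_antisymm j k]; rfl
    simp only [mpd_apply, Matrix.neg_apply, this, pd_neg]
  simp only [nablaCurv, h, curv_antisymm (G := G) j, curv_antisymm (G := G) _ k, smul_neg,
    Finset.sum_neg_distrib, Matrix.mul_neg, Matrix.neg_mul]
  abel

/-- In the cyclic sum the Γ-terms on the two form indices cancel by symmetry of Γ, so
`bianchi_second` already holds for the full covariant derivative. -/
theorem bianchi (hy : y ∈ s) (i j k : Fin n) :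
    nablaCurv G y i j k + nablaCurv G y j k i + nablaCurv G y k i j = 0 := by
  rw [← hG.bianchi_second hy i j k]
  simp only [nablaCurv]
  have h1 : ∀ i j k, ∑ a, christoffel G y a i j • curv G k a y =
      -∑ a, christoffel G y a j i • curv G a k y := by
    intro i j k
    rw [← Finset.sum_neg_distrib]
    refine Finset.sum_congr rfl fun a _ => ?_
    rw [curv_antisymm k a, hG.christoffel_symm hy, smul_neg]
  rw [h1 i k j, h1 j i k, h1 k j i]
  abel

/-- Lowering the index commutes with ∇: the derivative of `G` supplied by `mpd_metric` trades the
lower-index correction for the upper-index one. -/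
theorem nabla4_riemannLow (hy : y ∈ s) (q j k l m : Fin n) :
    nabla4 G (riemannLow G) y q j k l m = (G y * nablaCurv G y q j k) m l := by
  have hs := hG.smooth y hy
  have hc := hG.smooth_curv hy j k
  have e1 : pd q (fun z => riemannLow G z j k l m) y =
      (mpd q G y * curv G j k y + G y * mpd q (curv G j k) y) m l := by
    rw [← mpd_mul hs hc]
    simp only [riemannLow_eq, mpd_apply]
  have e2 : ∑ a, christoffel G y a q j * riemannLow G y a k l m =
      (G y * ∑ a, christoffel G y a q j • curv G a k y) m l := by
    simp only [Matrix.mul_sum, Matrix.sum_apply, Matrix.mul_smul, Matrix.smul_apply, riemannLow_eq,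
      smul_eq_mul]
  have e3 : ∑ a, christoffel G y a q k * riemannLow G y j a l m =
      (G y * ∑ a, christoffel G y a q k • curv G j a y) m l := by
    simp only [Matrix.mul_sum, Matrix.sum_apply, Matrix.mul_smul, Matrix.smul_apply, riemannLow_eq,
      smul_eq_mul]
  have e4 : ∑ a, christoffel G y a q l * riemannLow G y j k a m =
      (G y * curv G j k y * conn G q y) m l := by
    rw [Matrix.mul_apply]
    exact Finset.sum_congr rfl fun a _ => by rw [riemannLow_eq, conn_apply, mul_comm]
  have e5 : ∑ a, christoffel G y a q m * riemannLow G y j k l a =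
      ((conn G q y)ᵀ * (G y * curv G j k y)) m l := by
    rw [Matrix.mul_apply]
    exact Finset.sum_congr rfl fun a _ => by
      rw [riemannLow_eq, Matrix.transpose_apply, conn_apply]
  rw [nabla4, e1, e2, e3, e4, e5, hG.mpd_metric hy, nablaCurv]
  simp only [← Matrix.sub_apply]
  refine congrFun (congrFun ?_ m) l
  simp only [Matrix.mul_sub, Matrix.mul_add, Matrix.add_mul, Matrix.mul_assoc]
  abel

/-- The trace of the differentiated curvature is the differentiated Ricci tensor. -/
theorem trace_nablaCurv (hy : y ∈ s) (j k l : Fin n) :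
    ∑ q, nablaCurv G y j q k q l = -nabla2 G (ricci G) y j k l := by
  have hc := fun q => (hG.smooth_curv hy q k).differentiableAt q l
  have e1 : pd j (fun z => ricci G z k l) y = -∑ q, pd j (fun z => curv G q k z q l) y := by
    have : ∀ z, ricci G z k l = -∑ q, curv G q k z q l := fun z => rfl
    simp only [this, pd_neg]
    rw [pd_sum fun q _ => hc q]
  -- The corrections on the traced upper and lower indices cancel each other.
  have e2 : ∑ q, ∑ a, christoffel G y q j a * curv G q k y a l =
      ∑ q, ∑ a, christoffel G y a j q * curv G a k y q l := Finset.sum_comm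
  have e3 : ∑ q, ∑ a, curv G q k y q a * christoffel G y a j l =
      -∑ a, christoffel G y a j l * ricci G y k a := by
    rw [Finset.sum_comm, ← Finset.sum_neg_distrib]
    refine Finset.sum_congr rfl fun a _ => ?_
    rw [ricci, mul_neg, neg_neg, ← Finset.sum_mul, mul_comm]
    rfl
  have e4 : ∑ q, ∑ a, christoffel G y a j k * curv G q a y q l =
      -∑ a, christoffel G y a j k * ricci G y a l := by
    rw [Finset.sum_comm, ← Finset.sum_neg_distrib]
    refine Finset.sum_congr rfl fun a _ => ?_
    rw [ricci, mul_neg, neg_neg, ← Finset.mul_sum]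
    rfl
  have e5 : ∀ q, nablaCurv G y j q k q l = pd j (fun z => curv G q k z q l) y +
      ∑ a, christoffel G y q j a * curv G q k y a l -
      ∑ a, curv G q k y q a * christoffel G y a j l -
      ∑ a, christoffel G y a j q * curv G a k y q l -
      ∑ a, christoffel G y a j k * curv G q a y q l := by
    intro q
    simp only [nablaCurv, Matrix.sub_apply, Matrix.add_apply, mpd_apply, Matrix.mul_apply,
      Matrix.sum_apply, Matrix.smul_apply, conn_apply, smul_eq_mul]
  simp only [e5, Finset.sum_add_distrib, Finset.sum_sub_distrib]
  rw [e2, e3, e4, nabla2, e1]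
  ring

/-- The contracted second Bianchi identity `∇^m R_{jklm} = ∇_k R_{jl} - ∇_j R_{kl}`. -/
theorem div_riemannLow (hy : y ∈ s) (j k l : Fin n) :
    ∑ m, ∑ q, (G y)⁻¹ m q * nabla4 G (riemannLow G) y q j k l m =
      nabla2 G (ricci G) y k j l - nabla2 G (ricci G) y j k l := by
  have e1 : ∑ m, ∑ q, (G y)⁻¹ m q * nabla4 G (riemannLow G) y q j k l m =
      ∑ q, nablaCurv G y q j k q l := by
    rw [Finset.sum_comm]
    refine Finset.sum_congr rfl fun q _ => ?_
    rw [← nonsing_inv_mul_cancel_left (G y) (nablaCurv G y q j k) (hG.isUnit_det hy),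
      Matrix.mul_apply]
    refine Finset.sum_congr rfl fun m _ => ?_
    rw [hG.nabla4_riemannLow hy, hG.inv_symm_apply hy m q]
  -- The Bianchi identity moves the derivative off the traced index, leaving two traces of Ricci
  -- type.
  have e2 : ∀ q, nablaCurv G y q j k q l =
      nablaCurv G y j q k q l - nablaCurv G y k q j q l := by
    intro q
    have h := congrFun (congrFun (hG.bianchi hy q j k) q) l
    rw [nablaCurv_antisymm j k q] at h
    simp only [Matrix.add_apply, Matrix.neg_apply, Matrix.zero_apply] at h
    linarith
  rw [e1]
  simp only [e2, Finset.sum_sub_distrib, hG.trace_nablaCurv hy]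
  ring

theorem riemannLow_trace (hy : y ∈ s) (k m : Fin n) :
    ∑ j, ∑ l, (G y)⁻¹ j l * riemannLow G y j k l m = ricci G y k m := by
  rw [hG.ricci_eq hy, ← Finset.sum_neg_distrib]
  refine Finset.sum_congr rfl fun j _ => ?_
  rw [← Finset.sum_neg_distrib]
  refine Finset.sum_congr rfl fun l _ => ?_
  rw [hG.riemannLow_antisymm_right hy j k m l]
  ring

/-- The differentiated Ricci tensor is the trace of the differentiated lowered curvature. -/
theorem trace_nabla4_riemannLow (hy : y ∈ s) (q k m : Fin n) :
    ∑ j, ∑ l, (G y)⁻¹ j l * nabla4 G (riemannLow G) y q j k l m =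
      nabla2 G (ricci G) y q k m := by
  have h := hG.contract_nabla hy (S := fun z j l => riemannLow G z j k l m)
    (fun j l => hG.smooth_riemannLow hy j k l m) q
  have h1 : pd q (fun z => ∑ j, ∑ l, (G z)⁻¹ j l * riemannLow G z j k l m) y =
      pd q (fun z => ricci G z k m) y :=
    pd_congr (Filter.eventually_of_mem (hG.mem_nhds hy) fun z hz => hG.riemannLow_trace hz k m)
  -- For frozen k, m the curvature is a 2-tensor in the contracted indices j, l. The corrections on
  -- k and m pass through the trace and rebuild the covariant derivative of the Ricci tensor.
  have e1 : ∀ j l, nabla4 G (riemannLow G) y q j k l m =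
      nabla2 G (fun z j l => riemannLow G z j k l m) y q j l -
      ∑ a, christoffel G y a q k * riemannLow G y j a l m -
      ∑ a, christoffel G y a q m * riemannLow G y j k l a := by
    intro j l
    simp only [nabla4, nabla2]
    ring
  simp only [e1, mul_sub, Finset.sum_sub_distrib]
  rw [h, h1, sum_mul_sum_left_comm (fun m q => (G y)⁻¹ m q) (fun a => christoffel G y a q k) fun a j l => riemannLow G y j a l m,
    sum_mul_sum_left_comm (fun m q => (G y)⁻¹ m q) (fun a => christoffel G y a q m) fun a j l => riemannLow G y j k l a]
  simp only [hG.riemannLow_trace hy]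
  rw [nabla2]

end IsMetricOn

end Curvature

/-! ### Consequences of R_{kl} = ψ ξ_k ξ_l, up to the double divergence of the Weyl tensor. -/

section NullRicci

variable {n : ℕ} {G : Coord n → Matrix (Fin n) (Fin n) ℝ} {s : Set (Coord n)} {y : Coord n}
  {ξ : Coord n → Fin n → ℝ} {ψ : Coord n → ℝ}

namespace IsParallelNullOn

variable (hξ : IsParallelNullOn G ξ s) (hG : IsMetricOn G s)
  (hψ : ∀ y ∈ s, ∀ k l, ricci G y k l = ψ y * (ξ y k * ξ y l))

include hξ

theorem differentiableAt (hy : y ∈ s) (i : Fin n) : DifferentiableAt ℝ (fun z => ξ z i) y :=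
  differentiableAt_of_smooth (hξ.smooth y hy i)

/-- The covariant derivative of `f ξ ⊗ ξ`. -/
theorem nabla2_mul (hy : y ∈ s) {f : Coord n → ℝ} (hf : DifferentiableAt ℝ f y) (j k l : Fin n) :
    nabla2 G (fun z k l => f z * (ξ z k * ξ z l)) y j k l = pd j f y * (ξ y k * ξ y l) := by
  have hk := hξ.differentiableAt hy k
  have hl := hξ.differentiableAt hy l
  rw [nabla2, pd_mul hf (hk.fun_mul hl), pd_mul hk hl, hξ.parallel y hy, hξ.parallel y hy]
  have e1 : ∑ m, christoffel G y m j k * (f y * (ξ y m * ξ y l)) =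
      (∑ m, christoffel G y m j k * ξ y m) * (f y * ξ y l) := by
    rw [Finset.sum_mul]; exact Finset.sum_congr rfl fun m _ => by ring
  have e2 : ∑ m, christoffel G y m j l * (f y * (ξ y k * ξ y m)) =
      (∑ m, christoffel G y m j l * ξ y m) * (f y * ξ y k) := by
    rw [Finset.sum_mul]; exact Finset.sum_congr rfl fun m _ => by ring
  rw [e1, e2]
  ring

/-- The covariant derivative of `df ⊗ ξ ⊗ ξ`. -/
theorem nabla3_mul (hy : y ∈ s) {f : Coord n → ℝ} (hf : ContDiffAt ℝ ∞ f y) (i j k l : Fin n) :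
    nabla3 G (fun z j k l => pd j f z * (ξ z k * ξ z l)) y i j k l =
      hessian G f y i j * (ξ y k * ξ y l) := by
  have h := hξ.nabla2_mul hy (differentiableAt_of_smooth (smooth_pd (i := j) hf)) i k l
  have e1 : ∑ m, christoffel G y m i j * (pd m f y * (ξ y k * ξ y l)) =
      (∑ m, christoffel G y m i j * pd m f y) * (ξ y k * ξ y l) := by
    rw [Finset.sum_mul]; exact Finset.sum_congr rfl fun m _ => by ring
  rw [nabla2] at h
  rw [nabla3, hessian, e1]
  linarith

include hG

omit hξ in
theorem hessian_symm (hy : y ∈ s) {f : Coord n → ℝ} (hf : ContDiffAt ℝ ∞ f y) (i j : Fin n) :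
    hessian G f y i j = hessian G f y j i := by
  simp only [hessian, pd_comm (i := i) hf, hG.christoffel_symm hy _ i j]

omit hG in
theorem sum_inv_mul (hy : y ∈ s) : ∑ p, ∑ q, (G y)⁻¹ p q * (ξ y p * ξ y q) = 0 := by
  have h := hξ.null y hy
  simp only [dotProduct, mulVec, Finset.mul_sum] at h
  rw [← h]
  exact Finset.sum_congr rfl fun p _ => Finset.sum_congr rfl fun q _ => by ring

/-- If `ξ^p ∇_p f = 0` then `ξ^p ∇_p ∇_k f = 0`. -/
theorem hessian_null {f : Coord n → ℝ} (hf : ∀ y ∈ s, ContDiffAt ℝ ∞ f y)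
    (hξf : ∀ y ∈ s, ∑ p, ∑ q, (G y)⁻¹ p q * (ξ y p * pd q f y) = 0) (hy : y ∈ s) (k : Fin n) :
    ∑ p, ∑ q, (G y)⁻¹ p q * (ξ y p * hessian G f y q k) = 0 := by
  have hk := fun i => hξ.differentiableAt hy i
  have hd := fun i => differentiableAt_of_smooth (smooth_pd (i := i) (hf y hy))
  -- Differentiate the vanishing contraction of ξ ⊗ df. As ξ is parallel, only the Hessian term
  -- remains.
  have h := hG.contract_nabla hy (S := fun z p q => ξ z p * pd q f z)
    (fun p q => (hξ.smooth y hy p).mul (smooth_pd (hf y hy))) k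
  rw [pd_congr (h := fun _ => 0) (Filter.eventually_of_mem (hG.mem_nhds hy) hξf), pd_const] at h
  rw [← h]
  refine Finset.sum_congr rfl fun p _ => Finset.sum_congr rfl fun q _ => ?_
  have e1 : ∑ m, christoffel G y m k p * (ξ y m * pd q f y) =
      (∑ m, christoffel G y m k p * ξ y m) * pd q f y := by
    rw [Finset.sum_mul]; exact Finset.sum_congr rfl fun m _ => by ring
  have e2 : ∑ m, christoffel G y m k q * (ξ y p * pd m f y) =
      ξ y p * ∑ m, christoffel G y m k q * pd m f y := by
    rw [Finset.mul_sum]; exact Finset.sum_congr rfl fun m _ => by ring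
  rw [nabla2, e1, e2, pd_mul (hk p) (hd q), hξ.parallel y hy, hessian_symm hG hy (hf y hy),
    hessian]
  ring

include hψ

/-- Near a point where some ξ_i ≠ 0, ψ is the quotient R_{ii} / ξ_i². -/
theorem smooth_ricci_factor (hy : y ∈ s) : ContDiffAt ℝ ∞ ψ y := by
  obtain ⟨i, hi⟩ := Function.ne_iff.1 (hξ.ne_zero y hy)
  rw [Pi.zero_apply] at hi
  have hs := hξ.smooth y hy i
  have h1 : ∀ᶠ z in 𝓝 y, ξ z i ≠ 0 := hs.continuousAt.eventually_ne hi
  refine ContDiffAt.congr_of_eventuallyEq ((hG.smooth_ricci hy i i).div (hs.mul hs)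
    (mul_ne_zero hi hi)) ?_
  filter_upwards [h1, hG.mem_nhds hy] with z hz hzs
  change ψ z = ricci G z i i / (ξ z i * ξ z i)
  rw [hψ z hzs, mul_div_cancel_right₀ _ (mul_ne_zero hz hz)]

omit hξ in
theorem ricci_eventuallyEq (hy : y ∈ s) :
    ricci G =ᶠ[𝓝 y] fun z k l => ψ z * (ξ z k * ξ z l) := by
  filter_upwards [hG.mem_nhds hy] with z hz
  funext k l
  exact hψ z hz k l

theorem nabla2_ricci (hy : y ∈ s) (j k l : Fin n) :
    nabla2 G (ricci G) y j k l = pd j ψ y * (ξ y k * ξ y l) := by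
  rw [nabla2_congr (ricci_eventuallyEq hG hψ hy)]
  exact hξ.nabla2_mul hy (differentiableAt_of_smooth (hξ.smooth_ricci_factor hG hψ hy)) j k l

theorem nabla3_nabla2_ricci (hy : y ∈ s) (i j k l : Fin n) :
    nabla3 G (nabla2 G (ricci G)) y i j k l = hessian G ψ y i j * (ξ y k * ξ y l) := by
  rw [nabla3_congr (T' := fun z j k l => pd j ψ z * (ξ z k * ξ z l))]
  · exact hξ.nabla3_mul hy (hξ.smooth_ricci_factor hG hψ hy) i j k l
  · filter_upwards [hG.mem_nhds hy] with z hz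
    funext j k l
    exact hξ.nabla2_ricci hG hψ hz j k l

omit hG in
theorem scalarCurv_eq_zero (hy : y ∈ s) : scalarCurv G y = 0 := by
  simp only [scalarCurv, hψ y hy, mul_left_comm _ (ψ y), ← Finset.mul_sum,
    hξ.sum_inv_mul hy, mul_zero]

/-- The double trace of ∇Riem is evaluated in two orders. Taking the divergence first gives -v ξ_k,
where nullity of ξ removes the scalar curvature term; taking the Ricci trace first gives v ξ_k.
Since some ξ_k ≠ 0, v = 0. -/
theorem sum_inv_mul_pd (hy : y ∈ s) :
    ∑ p, ∑ q, (G y)⁻¹ p q * (ξ y p * pd q ψ y) = 0 := by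
  set v := ∑ p, ∑ q, (G y)⁻¹ p q * (ξ y p * pd q ψ y) with hv
  obtain ⟨k, hk⟩ := Function.ne_iff.1 (hξ.ne_zero y hy)
  rw [Pi.zero_apply] at hk
  have hsym : ∑ p, ∑ q, (G y)⁻¹ p q * (pd p ψ y * ξ y q) = v := by
    rw [hv, Finset.sum_comm]
    refine Finset.sum_congr rfl fun p _ => Finset.sum_congr rfl fun q _ => ?_
    rw [hG.inv_symm_apply hy]; ring
  have h1 : ∑ j, ∑ l, (G y)⁻¹ j l *
      ∑ m, ∑ q, (G y)⁻¹ m q * nabla4 G (riemannLow G) y q j k l m = -(v * ξ y k) := by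
    simp only [hG.div_riemannLow hy, hξ.nabla2_ricci hG hψ hy]
    have e : ∀ j l, (G y)⁻¹ j l * (pd k ψ y * (ξ y j * ξ y l) - pd j ψ y * (ξ y k * ξ y l)) =
        pd k ψ y * ((G y)⁻¹ j l * (ξ y j * ξ y l)) +
        (-ξ y k) * ((G y)⁻¹ j l * (pd j ψ y * ξ y l)) := by intros; ring
    simp only [e, Finset.sum_add_distrib, ← Finset.mul_sum, hsym, hξ.sum_inv_mul hy]
    ring
  have h2 : ∑ j, ∑ l, (G y)⁻¹ j l *
      ∑ m, ∑ q, (G y)⁻¹ m q * nabla4 G (riemannLow G) y q j k l m = v * ξ y k := by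
    have e1 : ∑ m, ∑ q, (G y)⁻¹ m q *
        ∑ j, ∑ l, (G y)⁻¹ j l * nabla4 G (riemannLow G) y q j k l m = v * ξ y k := by
      simp only [hG.trace_nabla4_riemannLow hy, hξ.nabla2_ricci hG hψ hy]
      have e : ∀ m q, (G y)⁻¹ m q * (pd q ψ y * (ξ y k * ξ y m)) =
          ξ y k * ((G y)⁻¹ m q * (ξ y m * pd q ψ y)) := by intros; ring
      simp only [e, ← Finset.mul_sum]
      rw [← hv, mul_comm]
    rw [← e1]
    have e2 : ∀ f : Fin n → Fin n → Fin n → Fin n → ℝ,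
        ∑ j, ∑ l, (G y)⁻¹ j l * ∑ m, ∑ q, (G y)⁻¹ m q * f q j l m =
        ∑ m, ∑ q, (G y)⁻¹ m q * ∑ j, ∑ l, (G y)⁻¹ j l * f q j l m := by
      intro f
      simp only [Finset.mul_sum]
      rw [sum_rotate]
      refine Finset.sum_congr rfl fun m _ => ?_
      rw [sum_rotate]
      simp only [mul_left_comm]
    exact e2 fun q j l m => nabla4 G (riemannLow G) y q j k l m
  have h3 : v * ξ y k = 0 := by linarith
  exact (mul_eq_zero.1 h3).resolve_right hk

omit hG in
-- The scalar curvature term drops out. The grouping into nested sums of scalar multiples is the one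
-- that `nabla4_add` and `nabla4_const_mul` consume.
theorem weyl_eq (hy : y ∈ s) (j k l m : Fin n) : weyl G y j k l m = riemannLow G y j k l m +
    (1 / ((n : ℝ) - 2) * (G y j m * ricci G y k l) + -(1 / ((n : ℝ) - 2)) * (G y k m * ricci G y j l) +
    (1 / ((n : ℝ) - 2) * (G y k l * ricci G y j m) +
      -(1 / ((n : ℝ) - 2)) * (G y j l * ricci G y k m))) := by
  rw [weyl, hξ.scalarCurv_eq_zero hψ hy]
  ring

theorem nabla4_weyl (hy : y ∈ s) (q j k l m : Fin n) : nabla4 G (weyl G) y q j k l m =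
    nabla4 G (riemannLow G) y q j k l m + 1 / ((n : ℝ) - 2) * (G y j m * nabla2 G (ricci G) y q k l -
      G y k m * nabla2 G (ricci G) y q j l + G y k l * nabla2 G (ricci G) y q j m -
      G y j l * nabla2 G (ricci G) y q k m) := by
  have hs : ∀ a b c d, ContDiffAt ℝ ∞ (fun z => G z a b * ricci G z c d) y := fun a b c d =>
    (hG.smooth y hy a b).mul (hG.smooth_ricci hy c d)
  have hsc : ∀ (r : ℝ) a b c d, ContDiffAt ℝ ∞ (fun z => r * (G z a b * ricci G z c d)) y :=
    fun r a b c d => contDiffAt_const.mul (hs a b c d)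
  have h1 : ∀ j k l m, nabla4 G (fun z j k l m => G z j m * ricci G z k l) y q j k l m =
      G y j m * nabla2 G (ricci G) y q k l :=
    hG.nabla4_metric_mul hy (T := ricci G) (fun k l => hG.smooth_ricci hy k l) q
  have h2 : ∀ j k l m, nabla4 G (fun z j k l m => G z k m * ricci G z j l) y q j k l m =
      G y k m * nabla2 G (ricci G) y q j l := by
    intro j k l m
    rw [← h1 k j l m, ← IsMetricOn.nabla4_swap_left]
  have h3 : ∀ j k l m, nabla4 G (fun z j k l m => G z j l * ricci G z k m) y q j k l m =
      G y j l * nabla2 G (ricci G) y q k m := by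
    intro j k l m
    rw [← h1 j k m l, ← IsMetricOn.nabla4_swap_right]
  have h4 : ∀ j k l m, nabla4 G (fun z j k l m => G z k l * ricci G z j m) y q j k l m =
      G y k l * nabla2 G (ricci G) y q j m := by
    intro j k l m
    rw [← h3 k j l m, ← IsMetricOn.nabla4_swap_left]
  rw [nabla4_congr (T' := fun z j k l m => riemannLow G z j k l m +
    (1 / ((n : ℝ) - 2) * (G z j m * ricci G z k l) + -(1 / ((n : ℝ) - 2)) * (G z k m * ricci G z j l) +
    (1 / ((n : ℝ) - 2) * (G z k l * ricci G z j m) +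
      -(1 / ((n : ℝ) - 2)) * (G z j l * ricci G z k m)))) ?_]
  · rw [nabla4_add (hG.smooth_riemannLow hy) fun j k l m =>
        ((hsc _ _ _ _ _).add (hsc _ _ _ _ _)).add ((hsc _ _ _ _ _).add (hsc _ _ _ _ _)),
      nabla4_add (fun j k l m => (hsc _ _ _ _ _).add (hsc _ _ _ _ _))
        (fun j k l m => (hsc _ _ _ _ _).add (hsc _ _ _ _ _)),
      nabla4_add (fun j k l m => hsc _ _ _ _ _) (fun j k l m => hsc _ _ _ _ _),
      nabla4_add (fun j k l m => hsc _ _ _ _ _) (fun j k l m => hsc _ _ _ _ _),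
      nabla4_const_mul _ (fun j k l m => hs _ _ _ _), nabla4_const_mul _ (fun j k l m => hs _ _ _ _),
      nabla4_const_mul _ (fun j k l m => hs _ _ _ _), nabla4_const_mul _ (fun j k l m => hs _ _ _ _),
      h1, h2, h3, h4]
    ring
  · filter_upwards [hG.mem_nhds hy] with z hz
    funext j k l m
    exact hξ.weyl_eq hψ hz j k l m

/-- The divergence of the Weyl tensor. -/
theorem div_weyl (hn : (n : ℝ) - 2 ≠ 0) (hy : y ∈ s) (j k l : Fin n) :
    ∑ m, ∑ q, (G y)⁻¹ m q * nabla4 G (weyl G) y q j k l m =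
      -(((n : ℝ) - 3) / ((n : ℝ) - 2)) * ((pd j ψ y * ξ y k - pd k ψ y * ξ y j) * ξ y l) := by
  have hinv : ∀ (a : Fin n) (f : Fin n → ℝ), ∑ m, ∑ q, (G y)⁻¹ m q * (G y a m * f q) = f a := by
    intro a f
    rw [Finset.sum_comm]
    have e : ∀ q, ∑ m, (G y)⁻¹ m q * (G y a m * f q) = (if q = a then 1 else 0) * f q := by
      intro q
      rw [← hG.inv_mul_apply hy, Finset.sum_mul]
      refine Finset.sum_congr rfl fun m _ => ?_
      rw [hG.inv_symm_apply hy, hG.symm_apply hy a m]; ring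
    simp only [e]
    simp
  -- The Ricci tensor is divergence-free, because ξ^p ∂_pψ = 0.
  have hz : ∀ b, ∑ m, ∑ q, (G y)⁻¹ m q * nabla2 G (ricci G) y q b m = 0 := by
    intro b
    have e : ∀ m q, (G y)⁻¹ m q * (pd q ψ y * (ξ y b * ξ y m)) =
        ξ y b * ((G y)⁻¹ m q * (ξ y m * pd q ψ y)) := by intros; ring
    simp only [hξ.nabla2_ricci hG hψ hy, e, ← Finset.mul_sum, hξ.sum_inv_mul_pd hG hψ hy, mul_zero]
  have e : ∀ m q, (G y)⁻¹ m q * nabla4 G (weyl G) y q j k l m =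
      (G y)⁻¹ m q * nabla4 G (riemannLow G) y q j k l m +
      1 / ((n : ℝ) - 2) * ((G y)⁻¹ m q * (G y j m * nabla2 G (ricci G) y q k l)) +
      (-(1 / ((n : ℝ) - 2))) * ((G y)⁻¹ m q * (G y k m * nabla2 G (ricci G) y q j l)) +
      1 / ((n : ℝ) - 2) * G y k l * ((G y)⁻¹ m q * nabla2 G (ricci G) y q j m) +
      (-(1 / ((n : ℝ) - 2) * G y j l)) * ((G y)⁻¹ m q * nabla2 G (ricci G) y q k m) := by
    intro m q
    rw [hξ.nabla4_weyl hG hψ hy]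
    ring
  simp only [e, Finset.sum_add_distrib, ← Finset.mul_sum, hz, hG.div_riemannLow hy]
  rw [hinv j fun q => nabla2 G (ricci G) y q k l, hinv k fun q => nabla2 G (ricci G) y q j l]
  simp only [hξ.nabla2_ricci hG hψ hy]
  -- The Riemann part and the Ricci part combine with 1 - 1/(n-2) = (n-3)/(n-2).
  field_simp
  ring

theorem smooth_nabla4_weyl (hy : y ∈ s) (q j k l m : Fin n) :
    ContDiffAt ℝ ∞ (fun z => nabla4 G (weyl G) z q j k l m) y := by
  have hsw : ∀ j k l m, ContDiffAt ℝ ∞ (fun z => weyl G z j k l m) y := by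
    intro j k l m
    have hs : ∀ (r : ℝ) a b c d, ContDiffAt ℝ ∞ (fun z => r * (G z a b * ricci G z c d)) y :=
      fun r a b c d => contDiffAt_const.mul ((hG.smooth y hy a b).mul (hG.smooth_ricci hy c d))
    refine ContDiffAt.congr_of_eventuallyEq ((hG.smooth_riemannLow hy j k l m).add
      (((hs (1 / ((n : ℝ) - 2)) j m k l).add (hs (-(1 / ((n : ℝ) - 2))) k m j l)).add
        ((hs (1 / ((n : ℝ) - 2)) k l j m).add (hs (-(1 / ((n : ℝ) - 2))) j l k m)))) ?_
    filter_upwards [hG.mem_nhds hy] with z hz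
    exact hξ.weyl_eq hψ hz j k l m
  have hc := hG.smooth_christoffel hy
  exact ((((smooth_pd (hsw j k l m)).sub (smooth_sum fun a _ => (hc a q j).mul (hsw _ _ _ _))).sub
    (smooth_sum fun a _ => (hc a q k).mul (hsw _ _ _ _))).sub
    (smooth_sum fun a _ => (hc a q l).mul (hsw _ _ _ _))).sub
    (smooth_sum fun a _ => (hc a q m).mul (hsw _ _ _ _))

/-- The double divergence of the Weyl tensor. -/
theorem divDivWeyl_eq (hn : (n : ℝ) - 2 ≠ 0) (hy : y ∈ s) (k l : Fin n) :
    divDivWeyl G y k l = -(((n : ℝ) - 3) / ((n : ℝ) - 2)) * laplacianRicci G y k l := by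
  set c : ℝ := -(((n : ℝ) - 3) / ((n : ℝ) - 2)) with hc
  set W : Coord n → Fin n → Fin n → Fin n → ℝ := fun z j k l =>
    ∑ m, ∑ q, (G z)⁻¹ m q * nabla4 G (weyl G) z q j k l m with hW
  have hψs := fun z hz => hξ.smooth_ricci_factor hG hψ (y := z) hz
  have hWs : ∀ z ∈ s, ∀ j k l, W z j k l =
      c * (pd j ψ z * (ξ z k * ξ z l)) + (-c) * (pd k ψ z * (ξ z j * ξ z l)) := by
    intro z hz j k l
    rw [hW, hc]
    simp only
    rw [hξ.div_weyl hG hψ hn hz]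
    ring
  -- The inner contraction commutes with the outer derivative, so the double divergence becomes the
  -- divergence of the 3-tensor `W`.
  have h1 : ∀ p j, ∑ m, ∑ q, (G y)⁻¹ m q * nabla5 G (nabla4 G (weyl G)) y p q j k l m =
      nabla3 G W y p j k l := by
    intro p j
    have h := hG.contract_nabla hy (S := fun z m q => nabla4 G (weyl G) z q j k l m)
      (fun m q => hξ.smooth_nabla4_weyl hG hψ hy q j k l m) p
    have e1 : ∀ m q, nabla5 G (nabla4 G (weyl G)) y p q j k l m =
        nabla2 G (fun z m q => nabla4 G (weyl G) z q j k l m) y p m q -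
        ∑ a, christoffel G y a p j * nabla4 G (weyl G) y q a k l m -
        ∑ a, christoffel G y a p k * nabla4 G (weyl G) y q j a l m -
        ∑ a, christoffel G y a p l * nabla4 G (weyl G) y q j k a m := by
      intro m q
      simp only [nabla5, nabla2]
      ring
    simp only [e1, mul_sub, Finset.sum_sub_distrib]
    rw [h, sum_mul_sum_left_comm (fun m q => (G y)⁻¹ m q) (fun a => christoffel G y a p j) fun a m q => nabla4 G (weyl G) y q a k l m,
      sum_mul_sum_left_comm (fun m q => (G y)⁻¹ m q) (fun a => christoffel G y a p k) fun a m q => nabla4 G (weyl G) y q j a l m,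
      sum_mul_sum_left_comm (fun m q => (G y)⁻¹ m q) (fun a => christoffel G y a p l) fun a m q => nabla4 G (weyl G) y q j k a m]
    rfl
  have h2 : ∀ p j, nabla3 G W y p j k l = c * (hessian G ψ y p j * (ξ y k * ξ y l)) +
      (-c) * (hessian G ψ y p k * (ξ y j * ξ y l)) := by
    intro p j
    rw [← hξ.nabla3_mul hy (hψs y hy), ← hξ.nabla3_mul hy (hψs y hy)]
    rw [nabla3_congr (T' := fun z j k l =>
      c * (pd j ψ z * (ξ z k * ξ z l)) + (-c) * (pd k ψ z * (ξ z j * ξ z l)))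
      (by filter_upwards [hG.mem_nhds hy] with z hz; funext j k l; exact hWs z hz j k l)]
    have hd : ∀ a b c, DifferentiableAt ℝ (fun z => pd a ψ z * (ξ z b * ξ z c)) y := fun a b c =>
      (differentiableAt_of_smooth (smooth_pd (hψs y hy))).fun_mul
        ((hξ.differentiableAt hy b).fun_mul (hξ.differentiableAt hy c))
    simp only [nabla3, mul_add, Finset.sum_add_distrib, mul_left_comm _ c, mul_left_comm _ (-c),
      ← Finset.mul_sum]
    rw [pd_add ((hd _ _ _).const_mul c) ((hd _ _ _).const_mul (-c)), pd_const_mul c (hd _ _ _),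
      pd_const_mul (-c) (hd _ _ _)]
    ring
  have h3 : divDivWeyl G y k l = ∑ j, ∑ p, (G y)⁻¹ j p * nabla3 G W y p j k l := by
    simp only [divDivWeyl, covCovWeyl_eq, ← h1, Finset.mul_sum]
    refine Finset.sum_congr rfl fun j _ => ?_
    rw [Finset.sum_comm]
    exact Finset.sum_congr rfl fun p _ => Finset.sum_congr rfl fun m _ =>
      Finset.sum_congr rfl fun q _ => by ring
  -- This kills the second half of `h2` after contraction, where ξ_j meets the Hessian of ψ.
  have h4 := hξ.hessian_null hG hψs (fun z hz => hξ.sum_inv_mul_pd hG hψ hz) hy k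
  have h5 : laplacianRicci G y k l =
      ∑ j, ∑ p, (G y)⁻¹ j p * (hessian G ψ y p j * (ξ y k * ξ y l)) := by
    simp only [laplacianRicci, covCovRicci_eq, hξ.nabla3_nabla2_ricci hG hψ hy,
      hessian_symm hG hy (hψs y hy)]
  have e : ∀ j p, (G y)⁻¹ j p * nabla3 G W y p j k l =
      c * ((G y)⁻¹ j p * (hessian G ψ y p j * (ξ y k * ξ y l))) +
      (-c * ξ y l) * ((G y)⁻¹ j p * (ξ y j * hessian G ψ y p k)) := by
    intro j p
    rw [h2]; ring
  rw [h3, h5]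
  simp only [e, Finset.sum_add_distrib, ← Finset.mul_sum, h4]
  ring

end IsParallelNullOn

end NullRicci

/-- The Jacobian matrix `∂_i τ^a`. -/
noncomputable def jacobian {n : ℕ} (τ : Coord n → Coord n) (y : Coord n) :
    Matrix (Fin n) (Fin n) ℝ :=
  Matrix.of fun a i => pd i (fun z => τ z a) y

/-! ### Transformation laws of connection, curvature and Ricci tensor. -/

section ChangeOfCoordinates

variable {n : ℕ} {G G' : Coord n → Matrix (Fin n) (Fin n) ℝ} {s s' : Set (Coord n)} {y : Coord n}
  {τ : Coord n → Coord n}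

theorem smooth_coord (hτ : ContDiffAt ℝ ∞ τ y) (a : Fin n) : ContDiffAt ℝ ∞ (fun z => τ z a) y :=
  (EuclideanSpace.proj a : Coord n →L[ℝ] ℝ).contDiff.contDiffAt.comp y hτ

theorem smooth_jacobian (hτ : ContDiffAt ℝ ∞ τ y) : MSmooth (jacobian τ) y :=
  fun a _ => smooth_pd (smooth_coord hτ a)

theorem mpd_jacobian_symm (hτ : ContDiffAt ℝ ∞ τ y) (j a l : Fin n) :
    mpd j (jacobian τ) y a l = mpd l (jacobian τ) y a j :=
  pd_comm (smooth_coord hτ a)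

theorem MSmooth.comp {F : Coord n → Matrix (Fin n) (Fin n) ℝ} (hF : MSmooth F (τ y))
    (hτ : ContDiffAt ℝ ∞ τ y) : MSmooth (fun z => F (τ z)) y :=
  fun a b => (hF a b).comp y hτ

theorem mpd_comp {F : Coord n → Matrix (Fin n) (Fin n) ℝ} (hF : MSmooth F (τ y))
    (hτ : ContDiffAt ℝ ∞ τ y) (k : Fin n) :
    mpd k (fun z => F (τ z)) y = ∑ c, jacobian τ y c k • mpd c F (τ y) := by
  ext a b
  rw [mpd_apply, pd_comp (f := fun z => F z a b) (hF.differentiableAt a b)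
    (hτ.differentiableAt (by simp)), Matrix.sum_apply]
  exact Finset.sum_congr rfl fun c _ => mul_comm _ _

/-- The pullback of a matrix valued 1-form. -/
noncomputable def pullForm (τ : Coord n → Coord n)
    (A : Fin n → Coord n → Matrix (Fin n) (Fin n) ℝ) (j : Fin n) (y : Coord n) :
    Matrix (Fin n) (Fin n) ℝ :=
  ∑ b, jacobian τ y b j • A b (τ y)

theorem MSmooth.sum {ι : Type*} {u : Finset ι} {F : ι → Coord n → Matrix (Fin n) (Fin n) ℝ}
    (hF : ∀ b ∈ u, MSmooth (F b) y) : MSmooth (fun z => ∑ b ∈ u, F b z) y := by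
  intro a c
  simp only [Matrix.sum_apply]
  exact smooth_sum fun b hb => hF b hb a c

theorem smooth_pullForm {A : Fin n → Coord n → Matrix (Fin n) (Fin n) ℝ}
    (hA : ∀ b, MSmooth (A b) (τ y)) (hτ : ContDiffAt ℝ ∞ τ y) (j : Fin n) :
    MSmooth (pullForm τ A j) y :=
  MSmooth.sum fun b _ a c => (smooth_jacobian hτ b j).mul (((hA b).comp hτ) a c)

theorem mpd_pullForm {A : Fin n → Coord n → Matrix (Fin n) (Fin n) ℝ}
    (hA : ∀ b, MSmooth (A b) (τ y)) (hτ : ContDiffAt ℝ ∞ τ y) (k j : Fin n) :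
    mpd k (pullForm τ A j) y = ∑ b, mpd k (jacobian τ) y b j • A b (τ y) +
      ∑ b, ∑ c, (jacobian τ y b j * jacobian τ y c k) • mpd c (A b) (τ y) := by
  ext a d
  have hJ := fun b => differentiableAt_of_smooth (smooth_jacobian hτ b j)
  have hAd := fun b => differentiableAt_of_smooth ((hA b).comp hτ a d)
  have h1 : ∀ z, pullForm τ A j z a d = ∑ b, jacobian τ z b j * A b (τ z) a d := by
    intro z
    simp [pullForm, Matrix.sum_apply]
  simp only [mpd_apply, h1, Matrix.add_apply, Matrix.sum_apply, Matrix.smul_apply, smul_eq_mul]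
  rw [pd_sum (F := fun b z => jacobian τ z b j * A b (τ z) a d)
    fun b _ => (hJ b).fun_mul (hAd b), ← Finset.sum_add_distrib]
  refine Finset.sum_congr rfl fun b _ => ?_
  rw [pd_mul (hJ b) (hAd b)]
  have h2 := congrFun (congrFun (mpd_comp (hA b) hτ k) a) d
  simp only [mpd_apply, Matrix.sum_apply, Matrix.smul_apply, smul_eq_mul] at h2
  rw [h2, Finset.mul_sum]
  simp only [mul_assoc]

variable (hG : IsMetricOn G s) (hG' : IsMetricOn G' s') (hτ : ∀ y ∈ s', ContDiffAt ℝ ∞ τ y)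
  (hmap : ∀ y ∈ s', τ y ∈ s)
  (hpull : ∀ y ∈ s', G' y = (jacobian τ y)ᵀ * G (τ y) * jacobian τ y)

include hG' hpull in
theorem isUnit_det_jacobian (hy : y ∈ s') : IsUnit (jacobian τ y).det := by
  have h := hG'.isUnit_det hy
  rw [hpull y hy, det_mul] at h
  exact isUnit_of_mul_isUnit_right h

include hG hG' hτ hmap hpull

/-- The transformation law of the Christoffel symbols. -/
theorem jacobian_mul_conn (hy : y ∈ s') (k : Fin n) :
    jacobian τ y * conn G' k y =
      pullForm τ (conn G) k y * jacobian τ y + mpd k (jacobian τ) y := by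
  set J := jacobian τ y with hJ
  have hJu : IsUnit J.det := isUnit_det_jacobian hG' hpull hy
  have hτy := hτ y hy
  have hGs := hG.smooth _ (hmap y hy)
  -- The right-hand side of the law. The matrices `J⁻¹ * K k` are shown to form a symmetric metric
  -- connection for `G'`, so uniqueness identifies them with its Levi-Civita connection.
  set K : Fin n → Matrix (Fin n) (Fin n) ℝ := fun k =>
    pullForm τ (conn G) k y * J + mpd k (jacobian τ) y with hK
  have hKs : ∀ j a l, K j a l = K l a j := by
    have h : ∀ j a l, (pullForm τ (conn G) j y * J) a l =
        ∑ b, ∑ c, J b j * J c l * christoffel G (τ y) a b c := by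
      intro j a l
      rw [Matrix.mul_apply, Finset.sum_comm]
      refine Finset.sum_congr rfl fun c _ => ?_
      rw [pullForm, Matrix.sum_apply, Finset.sum_mul]
      refine Finset.sum_congr rfl fun b _ => ?_
      rw [Matrix.smul_apply, conn_apply, smul_eq_mul]
      ring
    intro j a l
    rw [hK]
    simp only [Matrix.add_apply]
    rw [mpd_jacobian_symm hτy, h, h, Finset.sum_comm]
    congr 1
    refine Finset.sum_congr rfl fun b _ => Finset.sum_congr rfl fun c _ => ?_
    rw [hG.christoffel_symm (hmap y hy)]
    ring
  have hJK : ∀ k, J * (J⁻¹ * K k) = K k := fun k => mul_nonsing_inv_cancel_left _ _ hJu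
  have hm : ∀ k, mpd k G' y = (J⁻¹ * K k)ᵀ * G' y + G' y * (J⁻¹ * K k) := by
    intro k
    have hGτ : mpd k (fun z => G (τ z)) y =
        (pullForm τ (conn G) k y)ᵀ * G (τ y) + G (τ y) * pullForm τ (conn G) k y := by
      rw [mpd_comp hGs hτy]
      simp only [pullForm, Matrix.transpose_sum, Matrix.sum_mul, Matrix.mul_sum,
        ← Finset.sum_add_distrib, Matrix.transpose_smul, Matrix.smul_mul, Matrix.mul_smul,
        ← smul_add]
      exact Finset.sum_congr rfl fun c _ => by rw [hG.mpd_metric (hmap y hy)]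
    have hJs := smooth_jacobian hτy
    rw [mpd_congr (H := fun z => (jacobian τ z)ᵀ * G (τ z) * jacobian τ z)
      (Filter.eventually_of_mem (hG'.mem_nhds hy) hpull),
      mpd_mul (hJs.transpose.mul (hGs.comp hτy)) hJs, mpd_mul hJs.transpose (hGs.comp hτy),
      mpd_transpose, hGτ, hpull y hy, ← hJ]
    have e1 : (J⁻¹ * K k)ᵀ * (Jᵀ * G (τ y) * J) = (J * (J⁻¹ * K k))ᵀ * G (τ y) * J := by
      rw [Matrix.transpose_mul J]; simp only [Matrix.mul_assoc]
    have e2 : Jᵀ * G (τ y) * J * (J⁻¹ * K k) = Jᵀ * G (τ y) * (J * (J⁻¹ * K k)) := by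
      simp only [Matrix.mul_assoc]
    rw [e1, e2, hJK, hK]
    simp only [Matrix.transpose_add, Matrix.transpose_mul]
    noncomm_ring
  have h := hG'.conn_unique hy (fun k => J⁻¹ * K k)
    (fun j m l => by simp only [Matrix.mul_apply, hKs j _ l]) hm k
  rw [← h, hJK]

/-- The transformation law of the curvature. -/
theorem jacobian_mul_curv (hy : y ∈ s') (j k : Fin n) :
    jacobian τ y * curv G' j k y =
      (∑ b, ∑ c, (jacobian τ y b j * jacobian τ y c k) • curv G b c (τ y)) * jacobian τ y := by
  set J := jacobian τ y with hJ
  set Θ := pullForm τ (conn G) with hΘ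
  have hτy := hτ y hy
  have hJs := smooth_jacobian hτy
  have hc := hG.smooth_conn (hmap y hy)
  have hc' := hG'.smooth_conn hy
  have hΘs : ∀ j, MSmooth (Θ j) y := smooth_pullForm hc hτy
  have law := fun k => jacobian_mul_conn hG hG' hτ hmap hpull hy k
  -- The derivative of the connection law. Antisymmetrising in j, k removes the second derivatives
  -- of the Jacobian and leaves the curvature of the pulled-back connection form.
  have hd : ∀ j k, mpd k (jacobian τ) y * conn G' j y + J * mpd k (conn G' j) y =
      mpd k (Θ j) y * J + Θ j y * mpd k (jacobian τ) y + mpd k (mpd j (jacobian τ)) y := by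
    intro j k
    rw [← mpd_mul hJs (hc' j), ← mpd_mul (hΘs j) hJs, ← mpd_add ((hΘs j).mul hJs) hJs.mpd]
    exact mpd_congr (Filter.eventually_of_mem (hG'.mem_nhds hy)
      fun z hz => jacobian_mul_conn hG hG' hτ hmap hpull hz j)
  have hJ' : ∀ k, mpd k (jacobian τ) y = J * conn G' k y - Θ k y * J := fun k => by
    rw [law k]; abel
  have h1 : J * curv G' j k y = (mpd k (Θ j) y - mpd j (Θ k) y + (Θ k y * Θ j y - Θ j y * Θ k y)) * J := by
    have e : ∀ j k, J * mpd k (conn G' j) y = mpd k (Θ j) y * J +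
        Θ j y * (J * conn G' k y - Θ k y * J) + mpd k (mpd j (jacobian τ)) y -
        (J * conn G' k y - Θ k y * J) * conn G' j y := by
      intro j k
      have := hd j k
      rw [hJ' k] at this
      rw [← this]; abel
    have e2 : J * curv G' j k y = J * mpd k (conn G' j) y - J * mpd j (conn G' k) y +
        (J * conn G' k y * conn G' j y - J * conn G' j y * conn G' k y) := by
      rw [curv_eq]; noncomm_ring
    rw [e2, e, e, mpd_comm (i := j) (j := k) hJs]
    noncomm_ring
  rw [h1]
  congr 1
  rw [mpd_pullForm hc hτy, mpd_pullForm hc hτy]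
  -- Symmetry of the second derivatives of τ makes the inhomogeneous terms of the pullback cancel.
  have e3 : ∀ b, mpd k (jacobian τ) y b j = mpd j (jacobian τ) y b k :=
    fun b => mpd_jacobian_symm hτy k b j
  have e4 : ∑ b, ∑ c, (jacobian τ y b k * jacobian τ y c j) • mpd c (conn G b) (τ y) =
      ∑ b, ∑ c, (J b j * J c k) • mpd b (conn G c) (τ y) := by
    rw [Finset.sum_comm]
    exact Finset.sum_congr rfl fun b _ => Finset.sum_congr rfl fun c _ => by rw [mul_comm]
  have e5 : Θ k y * Θ j y = ∑ b, ∑ c, (J b j * J c k) • (conn G c (τ y) * conn G b (τ y)) := by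
    simp only [hΘ, pullForm, Matrix.sum_mul, Matrix.mul_sum, Matrix.smul_mul, Matrix.mul_smul,
      Finset.smul_sum, smul_smul]
    rfl
  have e6 : Θ j y * Θ k y = ∑ b, ∑ c, (J b j * J c k) • (conn G b (τ y) * conn G c (τ y)) := by
    simp only [hΘ, pullForm, Matrix.sum_mul, Matrix.mul_sum, Matrix.smul_mul, Matrix.mul_smul,
      Finset.smul_sum, smul_smul]
    rw [Finset.sum_comm]
    exact Finset.sum_congr rfl fun b _ => Finset.sum_congr rfl fun c _ => by rw [mul_comm]
  simp only [e3, curv_eq, smul_add, smul_sub, Finset.sum_add_distrib, Finset.sum_sub_distrib]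
  rw [e4, e5, e6]
  abel

/-- The transformation law of the Ricci tensor. -/
theorem ricci_change (hy : y ∈ s') (k l : Fin n) :
    ricci G' y k l =
      ∑ a, ∑ b, jacobian τ y a k * jacobian τ y b l * ricci G (τ y) a b := by
  set J := jacobian τ y with hJ
  have hJu : IsUnit J.det := isUnit_det_jacobian hG' hpull hy
  have h1 : ∀ p, riemann G' y p k l p = ∑ a, J⁻¹ p a *
      ∑ d, ∑ b, ∑ c, J b p * J c k * curv G b c (τ y) a d * J d l := by
    intro p
    rw [← curv_apply, ← nonsing_inv_mul_cancel_left J (curv G' p k y) hJu,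
      jacobian_mul_curv hG hG' hτ hmap hpull hy, Matrix.mul_apply]
    refine Finset.sum_congr rfl fun a _ => ?_
    rw [Matrix.mul_apply]
    congr 1
    refine Finset.sum_congr rfl fun d _ => ?_
    simp only [Matrix.sum_apply, Matrix.smul_apply, smul_eq_mul, Finset.sum_mul]
    rfl
  -- The traced index meets `J` and `J⁻¹`, which collapse to a Kronecker delta.
  have hJJ : ∀ b a, ∑ p, J b p * J⁻¹ p a = if b = a then 1 else 0 := by
    intro b a
    have := congrFun (congrFun (mul_nonsing_inv J hJu) b) a
    rwa [Matrix.mul_apply, one_apply] at this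
  have h2 : ∑ p, riemann G' y p k l p =
      ∑ c, ∑ d, J c k * J d l * ∑ a, curv G a c (τ y) a d := by
    calc ∑ p, riemann G' y p k l p
        = ∑ p, ∑ a, ∑ d, ∑ b, ∑ c, (J b p * J⁻¹ p a) * (J c k * J d l * curv G b c (τ y) a d) := by
          refine Finset.sum_congr rfl fun p _ => ?_
          rw [h1]
          simp only [Finset.mul_sum]
          exact Finset.sum_congr rfl fun a _ => Finset.sum_congr rfl fun d _ =>
            Finset.sum_congr rfl fun b _ => Finset.sum_congr rfl fun c _ => by ring
      _ = ∑ a, ∑ d, ∑ b, ∑ c, (∑ p, J b p * J⁻¹ p a) * (J c k * J d l * curv G b c (τ y) a d) := by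
          simp only [Finset.sum_mul]
          rw [Finset.sum_comm]
          refine Finset.sum_congr rfl fun a _ => ?_
          rw [Finset.sum_comm]
          refine Finset.sum_congr rfl fun d _ => ?_
          rw [Finset.sum_comm]
          exact Finset.sum_congr rfl fun b _ => Finset.sum_comm
      _ = ∑ a, ∑ d, ∑ c, J c k * J d l * curv G a c (τ y) a d := by
          refine Finset.sum_congr rfl fun a _ => Finset.sum_congr rfl fun d _ => ?_
          simp only [hJJ, ← Finset.mul_sum]
          simp
      _ = ∑ c, ∑ d, J c k * J d l * ∑ a, curv G a c (τ y) a d := by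
          simp only [Finset.mul_sum]
          rw [sum_rotate]
          exact Finset.sum_congr rfl fun c _ => Finset.sum_comm
  rw [ricci, h2, ← Finset.sum_neg_distrib]
  refine Finset.sum_congr rfl fun c _ => ?_
  rw [← Finset.sum_neg_distrib]
  refine Finset.sum_congr rfl fun d _ => ?_
  rw [ricci, mul_neg]
  rfl

end ChangeOfCoordinates

/-! ### From the manifold to coordinate expressions. -/

section Charts

variable {n : ℕ} {M : Type*} [TopologicalSpace M] [ChartedSpace (Coord n) M]
  [IsManifold (𝓡 n) ∞ M] {φ φ' : OpenPartialHomeomorph M (Coord n)} {y : Coord n}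

omit [IsManifold (𝓡 n) ∞ M] in
theorem contMDiffAt_chart (hφ : φ ∈ charts n M) {p : M} (hp : p ∈ φ.source) :
    ContMDiffAt (𝓡 n) 𝓘(ℝ, Coord n) ∞ φ p :=
  contMDiffAt_of_mem_maximalAtlas hφ hp

omit [IsManifold (𝓡 n) ∞ M] in
theorem contMDiffOn_chart_symm (hφ : φ ∈ charts n M) :
    ContMDiffOn 𝓘(ℝ, Coord n) (𝓡 n) ∞ φ.symm φ.target :=
  contMDiffOn_symm_of_mem_maximalAtlas hφ

omit [IsManifold (𝓡 n) ∞ M] in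
theorem contMDiffAt_chart_symm (hφ : φ ∈ charts n M) (hy : y ∈ φ.target) :
    ContMDiffAt 𝓘(ℝ, Coord n) (𝓡 n) ∞ φ.symm y :=
  contMDiffAt_symm_of_mem_maximalAtlas hφ hy

/-- The coordinate field is the tangent map of the inverse chart applied to a constant field. -/
theorem contMDiffAt_coordVec (hφ : φ ∈ charts n M) (hy : y ∈ φ.target) (i : Fin n) :
    ContMDiffAt 𝓘(ℝ, Coord n) (𝓡 n).tangent ∞
      (fun z => TotalSpace.mk' (Coord n) (φ.symm z) (coordVec φ z i)) y := by
  have h1 := (contMDiffOn_chart_symm hφ).contMDiffOn_tangentMapWithin (m := ∞) (by simp)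
    φ.open_target.uniqueMDiffOn
  have h2 : ContMDiffAt 𝓘(ℝ, Coord n) (𝓘(ℝ, Coord n)).tangent ∞
      (fun z : Coord n => TotalSpace.mk' (Coord n) (E := TangentSpace 𝓘(ℝ, Coord n)) z
        (EuclideanSpace.single i (1 : ℝ) : Coord n)) y :=
    contMDiffAt_vectorSpace_iff_contDiffAt.2 contDiffAt_const
  have h3 := (h1 ⟨y, (EuclideanSpace.single i (1 : ℝ) : Coord n)⟩ hy).comp_of_eq
    (x := y) (s := φ.target) h2.contMDiffWithinAt (fun z hz => hz) rfl
  refine (h3.contMDiffAt (φ.open_target.mem_nhds hy)).congr_of_eventuallyEq ?_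
  filter_upwards [φ.open_target.mem_nhds hy] with z hz
  simp only [Function.comp, tangentMapWithin, coordVec]
  rw [mfderivWithin_of_isOpen φ.open_target hz]

omit [IsManifold (𝓡 n) ∞ M] in
theorem contDiffAt_comp_chart_symm (hφ : φ ∈ charts n M) (hφ' : φ' ∈ charts n M)
    (hy : y ∈ φ.target) (hy' : φ.symm y ∈ φ'.source) :
    ContDiffAt ℝ ∞ (fun z => φ' (φ.symm z)) y :=
  ((contMDiffAt_chart hφ' hy').comp y (contMDiffAt_chart_symm hφ hy)).contDiffAt

omit [IsManifold (𝓡 n) ∞ M] in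
theorem mfderiv_chart_coordVec (hφ : φ ∈ charts n M) (hy : y ∈ φ.target) (i : Fin n) :
    mfderiv (𝓡 n) 𝓘(ℝ, Coord n) φ (φ.symm y) (coordVec φ y i) =
      (EuclideanSpace.single i (1 : ℝ) : Coord n) := by
  have h1 := (contMDiffAt_chart hφ (φ.map_target hy)).mdifferentiableAt (by simp)
  have h2 := (contMDiffAt_chart_symm hφ hy).mdifferentiableAt (by simp)
  have h3 := mfderiv_comp y h1 h2
  have h4 : (φ ∘ φ.symm) =ᶠ[𝓝 y] id := by
    filter_upwards [φ.open_target.mem_nhds hy] with z hz using φ.right_inv hz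
  have h5 : fderiv ℝ (φ ∘ φ.symm) y = ContinuousLinearMap.id ℝ _ := by
    rw [h4.fderiv_eq, fderiv_id]
  rw [mfderiv_eq_fderiv, h5] at h3
  exact (congrArg (fun L : Coord n →L[ℝ] Coord n => L (EuclideanSpace.single i (1 : ℝ))) h3).symm

omit [IsManifold (𝓡 n) ∞ M] in
-- Chain rule for φ⁻¹ = φ'⁻¹ ∘ (φ' ∘ φ⁻¹). Both sides are read in `Coord n`, since their base points
-- are equal only propositionally.
theorem coordVec_change (hφ : φ ∈ charts n M) (hφ' : φ' ∈ charts n M)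
    (hy : y ∈ φ.target) (hy' : φ.symm y ∈ φ'.source) (i : Fin n) :
    (coordVec φ y i : Coord n) = ∑ a, jacobian (fun z => φ' (φ.symm z)) y a i •
      (coordVec φ' (φ' (φ.symm y)) a : Coord n) := by
  have hτ := contDiffAt_comp_chart_symm hφ hφ' hy hy'
  have hd := hτ.differentiableAt (by simp)
  have h1 := (contMDiffAt_chart_symm hφ' (φ'.map_source hy')).mdifferentiableAt (by simp)
  have h3 := mfderiv_comp (I := 𝓘(ℝ, Coord n)) y
    (f := fun z => φ' (φ.symm z)) h1 hd.mdifferentiableAt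
  have h4 : φ.symm =ᶠ[𝓝 y] φ'.symm ∘ fun z => φ' (φ.symm z) := by
    have := (φ.continuousAt_symm hy).preimage_mem_nhds (φ'.open_source.mem_nhds hy')
    filter_upwards [this] with z hz using (φ'.left_inv hz).symm
  have h5 := h4.mfderiv_eq (I := 𝓘(ℝ, Coord n)) (I' := 𝓡 n)
  rw [mfderiv_eq_fderiv] at h3
  have h6 : (coordVec φ y i : Coord n) = mfderiv 𝓘(ℝ, Coord n) (𝓡 n) φ'.symm (φ' (φ.symm y))
      (fderiv ℝ (fun z => φ' (φ.symm z)) y (EuclideanSpace.single i (1 : ℝ))) :=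
    congrArg (fun L : Coord n →L[ℝ] Coord n => L (EuclideanSpace.single i (1 : ℝ))) (h5.trans h3)
  rw [h6]
  have h7 : ∀ a, jacobian (fun z => φ' (φ.symm z)) y a i =
      (fderiv ℝ (fun z => φ' (φ.symm z)) y (EuclideanSpace.single i 1)) a := by
    intro a
    have h3 : HasFDerivAt (fun z => (φ' (φ.symm z)) a)
        ((EuclideanSpace.proj a : Coord n →L[ℝ] ℝ).comp
          (fderiv ℝ (fun z => φ' (φ.symm z)) y)) y :=
      (EuclideanSpace.proj a : Coord n →L[ℝ] ℝ).hasFDerivAt.comp y hd.hasFDerivAt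
    simp [jacobian, pd, h3.fderiv]
  simp only [h7]
  set v := fderiv ℝ (fun z => φ' (φ.symm z)) y (EuclideanSpace.single i 1) with hv
  have h8 : v = ∑ a, v a • (EuclideanSpace.single a (1 : ℝ) : Coord n) := by
    have := (EuclideanSpace.basisFun (Fin n) ℝ).sum_repr v
    simpa using this.symm
  conv_lhs => rw [h8]
  exact map_sum (mfderiv 𝓘(ℝ, Coord n) (𝓡 n) φ'.symm (φ' (φ.symm y)) : Coord n →L[ℝ] Coord n) _ _
    |>.trans (Finset.sum_congr rfl fun a _ => map_smul
      (mfderiv 𝓘(ℝ, Coord n) (𝓡 n) φ'.symm (φ' (φ.symm y)) : Coord n →L[ℝ] Coord n) _ _)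

variable (g : LorentzMetric n M)

theorem contMDiffAt_inner {v w : (z : Coord n) → TangentSpace (𝓡 n) (φ.symm z)}
    (hφ : φ ∈ charts n M) (hy : y ∈ φ.target)
    (hv : ContMDiffAt 𝓘(ℝ, Coord n) (𝓡 n).tangent ∞
      (fun z => TotalSpace.mk' (Coord n) (φ.symm z) (v z)) y)
    (hw : ContMDiffAt 𝓘(ℝ, Coord n) (𝓡 n).tangent ∞
      (fun z => TotalSpace.mk' (Coord n) (φ.symm z) (w z)) y) :
    ContDiffAt ℝ ∞ (fun z => g.inner (φ.symm z) (v z) (w z)) y := by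
  have h1 : ContMDiffAt 𝓘(ℝ, Coord n) ((𝓡 n).prod 𝓘(ℝ, ℝ)) ∞
      (fun z => TotalSpace.mk' ℝ (E := Bundle.Trivial M ℝ) (φ.symm z)
        (g.inner (φ.symm z) (v z) (w z))) y := by
    apply ContMDiffAt.clm_bundle_apply₂ (F₁ := Coord n) (F₂ := Coord n)
    · exact g.contMDiff.contMDiffAt.comp y (contMDiffAt_chart_symm hφ hy)
    · exact hv
    · exact hw
  rw [contMDiffAt_totalSpace] at h1
  exact h1.2.contDiffAt

theorem smooth_comp (hφ : φ ∈ charts n M) (hy : y ∈ φ.target) : MSmooth (g.comp φ) y :=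
  fun i j => contMDiffAt_inner g hφ hy (contMDiffAt_coordVec hφ hy i) (contMDiffAt_coordVec hφ hy j)

/-- In an orthonormal basis, the matrix of the metric in a chart is `Bᵀ η B`. -/
theorem exists_orthonormal_matrix (hφ : φ ∈ charts n M) (hy : y ∈ φ.target) :
    ∃ (b : Module.Basis (Fin n) ℝ (TangentSpace (𝓡 n) (φ.symm y)))
      (B : Matrix (Fin n) (Fin n) ℝ), IsUnit B.det ∧
      g.comp φ y = Bᵀ * diagonal (minkowski n) * B ∧
      (∀ v w, g.inner (φ.symm y) v w = b.repr v ⬝ᵥ (diagonal (minkowski n) *ᵥ b.repr w)) ∧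
      ∀ i, (b.repr (coordVec φ y i) : Fin n → ℝ) = fun p => B p i := by
  obtain ⟨b, hb⟩ := g.signature (φ.symm y)
  have hin : ∀ v w, g.inner (φ.symm y) v w =
      b.repr v ⬝ᵥ (diagonal (minkowski n) *ᵥ b.repr w) := by
    intro v w
    conv_lhs => rw [← b.sum_repr v, ← b.sum_repr w]
    simp only [map_sum, map_smul, _root_.sum_apply, _root_.smul_apply,
      hb, smul_eq_mul, dotProduct, mulVec_diagonal]
    refine Finset.sum_congr rfl fun p _ => ?_
    simp [minkowski, mul_comm]
  refine ⟨b, Matrix.of fun p i => b.repr (coordVec φ y i) p, ?_, ?_, hin, fun i => rfl⟩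
  -- `B` is invertible because the matrix of the differential of the chart in the basis `b` is a
  -- left inverse.
  · set L : TangentSpace (𝓡 n) (φ.symm y) →ₗ[ℝ] Coord n :=
      (mfderiv (𝓡 n) 𝓘(ℝ, Coord n) φ (φ.symm y) : _ →L[ℝ] Coord n).toLinearMap with hL
    have h : (Matrix.of fun j p => L (b p) j) * (Matrix.of fun p i => b.repr (coordVec φ y i) p) =
        1 := by
      ext j i
      have h1 : L (coordVec φ y i) = (EuclideanSpace.single i (1 : ℝ) : Coord n) :=
        mfderiv_chart_coordVec hφ hy i
      rw [← b.sum_repr (coordVec φ y i), map_sum] at h1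
      have h2 := congrArg (fun v : Coord n => v j) h1
      simp only [map_smul, WithLp.ofLp_sum, Finset.sum_apply, PiLp.smul_apply, smul_eq_mul] at h2
      rw [Matrix.mul_apply]
      simp only [of_apply]
      simp only [mul_comm] at h2 ⊢
      rw [h2, one_apply]
      simp
    exact isUnit_of_mul_isUnit_right (by rw [← det_mul, h, det_one]; exact isUnit_one)
  · ext i j
    rw [LorentzMetric.comp, of_apply, hin, Matrix.mul_assoc, Matrix.mul_apply]
    refine Finset.sum_congr rfl fun p _ => ?_
    simp [mulVec_diagonal, diagonal_mul]

theorem isMetricOn_comp (hφ : φ ∈ charts n M) : IsMetricOn (g.comp φ) φ.target where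
  isOpen := φ.open_target
  smooth _ hy := smooth_comp g hφ hy
  symm y _ := by
    ext i j
    exact g.symm _ _ _
  det_ne_zero y hy := by
    obtain ⟨b, B, hB, h, -⟩ := exists_orthonormal_matrix g hφ hy
    have h1 : (diagonal (minkowski n)).det * (diagonal (minkowski n)).det = 1 := by
      rw [← det_mul, minkowski_mul_self, det_one]
    rw [h, det_mul, det_mul, det_transpose]
    exact mul_ne_zero (mul_ne_zero hB.ne_zero (left_ne_zero_of_mul_eq_one h1)) hB.ne_zero

/-- The components of the 1-form metrically dual to the vector field `X`. -/
noncomputable def dualComp (X : (p : M) → TangentSpace (𝓡 n) p)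
    (φ : OpenPartialHomeomorph M (Coord n)) (y : Coord n) (i : Fin n) : ℝ :=
  formComp (fun p => g.inner p (X p)) φ y i

variable {g} {X : (p : M) → TangentSpace (𝓡 n) p}

theorem isParallelNullOn_dualComp (hX : g.IsParallelNull X) (hφ : φ ∈ charts n M) :
    IsParallelNullOn (g.comp φ) (dualComp g X φ) φ.target := by
  have key : ∀ y ∈ φ.target, dualComp g X φ y ⬝ᵥ ((g.comp φ y)⁻¹ *ᵥ dualComp g X φ y) = 0 ∧
      dualComp g X φ y ≠ 0 := by
    intro y hy
    have hdet := (isMetricOn_comp g hφ).isUnit_det hy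
    obtain ⟨b, B, hB, hGB, hin, hcv⟩ := exists_orthonormal_matrix g hφ hy
    set x : Fin n → ℝ := ⇑(b.repr (X (φ.symm y))) with hx
    have h1 : dualComp g X φ y = x ᵥ* (diagonal (minkowski n) * B) := by
      funext i
      rw [dualComp, formComp, hin, hcv, dotProduct_mulVec, ← vecMul_vecMul]
      rfl
    -- `B⁻¹ *ᵥ x` lists the coordinate components of X, so raising the index of the dual form
    -- recovers X. Nullity and non-vanishing of X thus pass to the form.
    have h2 : dualComp g X φ y = g.comp φ y *ᵥ (B⁻¹ *ᵥ x) := by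
      rw [hGB, mulVec_mulVec, Matrix.mul_assoc, mul_nonsing_inv _ hB, Matrix.mul_one, h1,
        ← mulVec_transpose, transpose_mul, diagonal_transpose]
    have h5 : (g.comp φ y)⁻¹ *ᵥ dualComp g X φ y = B⁻¹ *ᵥ x := by
      rw [h2, mulVec_mulVec (B⁻¹ *ᵥ x), nonsing_inv_mul _ hdet, one_mulVec]
    constructor
    · rw [h5, h1, ← dotProduct_mulVec, mulVec_mulVec, Matrix.mul_assoc, mul_nonsing_inv _ hB,
        Matrix.mul_one, ← hin]
      exact hX.null _
    · intro h0
      have h3 : B⁻¹ *ᵥ x = 0 := by rw [← h5, h0, mulVec_zero]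
      have h4 : x = 0 := by
        have := congrArg (fun v => B *ᵥ v) h3
        simpa [mul_nonsing_inv _ hB] using this
      refine hX.ne_zero (φ.symm y) (b.repr.injective ?_)
      ext p
      rw [map_zero]
      exact congrFun h4 p
  refine ⟨fun y hy i => ?_, fun y hy j k => ?_, fun y hy => (key y hy).1, fun y hy => (key y hy).2⟩
  · exact contMDiffAt_inner g hφ hy (v := fun z => X (φ.symm z))
      (hX.contMDiff.contMDiffAt.comp y (contMDiffAt_chart_symm hφ hy))
      (contMDiffAt_coordVec hφ hy i)
  · have h := hX.parallel φ hφ y hy j k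
    rw [covD_one_apply] at h
    exact sub_eq_zero.1 h

end Charts

theorem IsMetricOn.mono {n : ℕ} {G : Coord n → Matrix (Fin n) (Fin n) ℝ} {s t : Set (Coord n)}
    (hG : IsMetricOn G s) (ht : IsOpen t) (hts : t ⊆ s) : IsMetricOn G t where
  isOpen := ht
  smooth y hy := hG.smooth y (hts hy)
  symm y hy := hG.symm y (hts hy)
  det_ne_zero y hy := hG.det_ne_zero y (hts hy)

/-! ### The global factor Ψ and its logarithmic differential. -/

section Global

variable {n : ℕ} {M : Type*} [TopologicalSpace M] [ChartedSpace (Coord n) M]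
  [IsManifold (𝓡 n) ∞ M] {φ φ' : OpenPartialHomeomorph M (Coord n)} {y : Coord n}
  {g : LorentzMetric n M} {X : (p : M) → TangentSpace (𝓡 n) p}

theorem inner_congr {p q : M} (h : p = q) (v w : Coord n) :
    (g.inner p : Coord n →L[ℝ] Coord n →L[ℝ] ℝ) v w =
      (g.inner q : Coord n →L[ℝ] Coord n →L[ℝ] ℝ) v w := by
  subst h; rfl

theorem comp_change (hφ : φ ∈ charts n M) (hφ' : φ' ∈ charts n M)
    (hy : y ∈ φ.target) (hy' : φ.symm y ∈ φ'.source) :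
    g.comp φ y = (jacobian (fun z => φ' (φ.symm z)) y)ᵀ * g.comp φ' (φ' (φ.symm y)) *
      jacobian (fun z => φ' (φ.symm z)) y := by
  ext i j
  have h1 : g.comp φ y i j = (g.inner (φ'.symm (φ' (φ.symm y))) : Coord n →L[ℝ] Coord n →L[ℝ] ℝ)
      (coordVec φ y i) (coordVec φ y j) := inner_congr (φ'.left_inv hy').symm _ _
  rw [h1, coordVec_change hφ hφ' hy hy', coordVec_change hφ hφ' hy hy', Matrix.mul_apply]
  simp only [map_sum, map_smul, _root_.sum_apply, _root_.smul_apply, smul_eq_mul]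
  rw [Finset.sum_congr rfl fun b _ => ?_]
  rw [Matrix.mul_apply, Finset.sum_mul, Finset.mul_sum]
  refine Finset.sum_congr rfl fun a _ => ?_
  rw [transpose_apply, LorentzMetric.comp, of_apply]
  ring

theorem dualComp_change (hφ : φ ∈ charts n M) (hφ' : φ' ∈ charts n M)
    (hy : y ∈ φ.target) (hy' : φ.symm y ∈ φ'.source) (i : Fin n) :
    dualComp g X φ y i = ∑ a, jacobian (fun z => φ' (φ.symm z)) y a i *
      dualComp g X φ' (φ' (φ.symm y)) a := by
  have h0 : ∀ p q : M, p = q → ∀ w : Coord n,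
      (g.inner p (X p) : Coord n →L[ℝ] ℝ) w = (g.inner q (X q) : Coord n →L[ℝ] ℝ) w := by
    rintro p _ rfl w; rfl
  have h1 : dualComp g X φ y i = (g.inner (φ'.symm (φ' (φ.symm y)))
      (X (φ'.symm (φ' (φ.symm y)))) : Coord n →L[ℝ] ℝ) (coordVec φ y i) :=
    h0 _ _ (φ'.left_inv hy').symm _
  rw [h1, coordVec_change hφ hφ' hy hy', map_sum]
  exact Finset.sum_congr rfl fun a _ => by rw [map_smul]; rfl

/-- The Ricci tensor of a pp-wave is a global multiple of the square of the dual 1-form. -/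
theorem exists_global_factor (hX : g.IsParallelNull X)
    (hpp : ∀ φ ∈ charts n M, ∀ y ∈ φ.target, ∀ j k l m : Fin n,
      ∑ p, ∑ q, ∑ a, ∑ b, (g.comp φ y)⁻¹ p a * (g.comp φ y)⁻¹ q b *
        riemannLow (g.comp φ) y j k a b * riemannLow (g.comp φ) y p q l m = 0) :
    ∃ Ψ : M → ℝ, ∀ φ ∈ charts n M, ∀ y ∈ φ.target, ∀ k l,
      ricci (g.comp φ) y k l = Ψ (φ.symm y) * (dualComp g X φ y k * dualComp g X φ y l) := by
  have hloc : ∀ φ ∈ charts n M, ∀ y ∈ φ.target, ∃ c : ℝ, ∀ k l,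
      ricci (g.comp φ) y k l = c * (dualComp g X φ y k * dualComp g X φ y l) := by
    intro φ hφ y hy
    obtain ⟨b, B, -, hB, -⟩ := exists_orthonormal_matrix g hφ hy
    exact (isMetricOn_comp g hφ).exists_ricci_eq (isParallelNullOn_dualComp hX hφ) ⟨B, hB⟩
      (hpp φ hφ y hy) hy
  have hchart : ∀ p : M, chartAt (Coord n) p ∈ charts n M := fun p =>
    IsManifold.chart_mem_maximalAtlas p
  -- Ψ at `p` is defined in the preferred chart at `p`. Chart independence follows because Ricci and
  -- the square of the dual form transform with the same Jacobian factors.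
  choose Ψ hΨ using fun p : M => hloc _ (hchart p) (chartAt (Coord n) p p)
    ((chartAt (Coord n) p).map_source (mem_chart_source _ p))
  refine ⟨Ψ, fun φ hφ y hy k l => ?_⟩
  set φ' := chartAt (Coord n) (φ.symm y) with hφ'
  have hy' : φ.symm y ∈ φ'.source := mem_chart_source _ _
  have hc' : φ' ∈ charts n M := hchart _
  have hmem : y ∈ (φ.symm.trans φ').source := by
    rw [OpenPartialHomeomorph.trans_source]
    exact ⟨hy, hy'⟩
  have hsub : ∀ z ∈ (φ.symm.trans φ').source, z ∈ φ.target ∧ φ.symm z ∈ φ'.source := by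
    intro z hz
    rwa [OpenPartialHomeomorph.trans_source] at hz
  have h := ricci_change (isMetricOn_comp g hc')
    ((isMetricOn_comp g hφ).mono (φ.symm.trans φ').open_source fun z hz => (hsub z hz).1)
    (τ := fun z => φ' (φ.symm z))
    (fun z hz => contDiffAt_comp_chart_symm hφ hc' (hsub z hz).1 (hsub z hz).2)
    (fun z hz => φ'.map_source (hsub z hz).2)
    (fun z hz => comp_change hφ hc' (hsub z hz).1 (hsub z hz).2) hmem k l
  rw [h, dualComp_change hφ hc' hy hy' k, dualComp_change hφ hc' hy hy' l, Finset.sum_mul_sum,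
    Finset.mul_sum]
  refine Finset.sum_congr rfl fun a _ => ?_
  rw [Finset.mul_sum]
  refine Finset.sum_congr rfl fun b _ => ?_
  have h2 : ricci (g.comp φ') (φ' (φ.symm y)) a b = Ψ (φ.symm y) *
      (dualComp g X φ' (φ' (φ.symm y)) a * dualComp g X φ' (φ' (φ.symm y)) b) := hΨ _ a b
  rw [h2]
  ring

/-- The logarithmic differential `Ψ⁻¹ dΨ`. -/
noncomputable def logDifferential (Ψ : M → ℝ) (p : M) : TangentSpace (𝓡 n) p →L[ℝ] ℝ :=
  (Ψ p)⁻¹ • (mfderiv (𝓡 n) 𝓘(ℝ, ℝ) Ψ p : TangentSpace (𝓡 n) p →L[ℝ] ℝ)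

theorem contMDiffAt_of_smooth_in_charts {Ψ : M → ℝ}
    (hΨ : ∀ φ ∈ charts n M, ∀ y ∈ φ.target, ContDiffAt ℝ ∞ (fun z => Ψ (φ.symm z)) y) (p : M) :
    ContMDiffAt (𝓡 n) 𝓘(ℝ, ℝ) ∞ Ψ p := by
  set φ := chartAt (Coord n) p with hφ
  have hc : φ ∈ charts n M := IsManifold.chart_mem_maximalAtlas p
  have hp : p ∈ φ.source := mem_chart_source _ p
  have h1 := (hΨ φ hc (φ p) (φ.map_source hp)).contMDiffAt.comp p (contMDiffAt_chart hc hp)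
  refine h1.congr_of_eventuallyEq ?_
  filter_upwards [φ.open_source.mem_nhds hp] with q hq
  simp only [Function.comp, φ.left_inv hq]

theorem smoothFormOn_logDifferential {Ψ : M → ℝ} (hΨ : ∀ p, ContMDiffAt (𝓡 n) 𝓘(ℝ, ℝ) ∞ Ψ p)
    {U : Set M} (hU : ∀ p ∈ U, Ψ p ≠ 0) : SmoothFormOn (logDifferential (n := n) Ψ) U := by
  intro p hp
  apply ContMDiffAt.contMDiffWithinAt
  rw [contMDiffAt_hom_bundle]
  refine ⟨contMDiffAt_id, ?_⟩
  have h1 := (hΨ p).mfderiv_const (m := ∞) (by simp)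
  have h2 : ContMDiffAt (𝓡 n) 𝓘(ℝ, ℝ) ∞ (fun q => (Ψ q)⁻¹) p :=
    ((contDiffAt_inv ℝ (hU p hp)).contMDiffAt).comp p (hΨ p)
  refine (h2.smul h1).congr_of_eventuallyEq (Filter.Eventually.of_forall fun q => ?_)
  ext v
  simp [inTangentCoordinates, ContinuousLinearMap.inCoordinates, logDifferential]
  rfl

omit [IsManifold (𝓡 n) ∞ M] in
theorem formComp_logDifferential {Ψ : M → ℝ} (hΨ : ∀ p, ContMDiffAt (𝓡 n) 𝓘(ℝ, ℝ) ∞ Ψ p)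
    (hφ : φ ∈ charts n M) (hy : y ∈ φ.target) (j : Fin n) :
    formComp (logDifferential Ψ) φ y j =
      (Ψ (φ.symm y))⁻¹ * pd j (fun z => Ψ (φ.symm z)) y := by
  have h1 := (hΨ (φ.symm y)).mdifferentiableAt (by simp)
  have h2 := (contMDiffAt_chart_symm hφ hy).mdifferentiableAt (by simp)
  have h3 := mfderiv_comp y h1 h2
  rw [mfderiv_eq_fderiv] at h3
  have h4 : pd j (fun z => Ψ (φ.symm z)) y =
      mfderiv (𝓡 n) 𝓘(ℝ, ℝ) Ψ (φ.symm y) (coordVec φ y j) :=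
    congrArg (fun L : Coord n →L[ℝ] ℝ => L (EuclideanSpace.single j (1 : ℝ))) h3
  rw [h4]
  rfl

omit [IsManifold (𝓡 n) ∞ M] in
-- The differential of Ψ⁻¹ dΨ consists of -Ψ⁻² ∂_iΨ ∂_jΨ and Ψ⁻¹ ∂_i∂_jΨ, both symmetric in i, j.
theorem closedFormOn_logDifferential {Ψ : M → ℝ} (hΨ : ∀ p, ContMDiffAt (𝓡 n) 𝓘(ℝ, ℝ) ∞ Ψ p)
    {U : Set M} (hU : ∀ p ∈ U, Ψ p ≠ 0) : ClosedFormOn (logDifferential (n := n) Ψ) U := by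
  intro φ hφ y hy hyU
  set ψ : Coord n → ℝ := fun z => Ψ (φ.symm z) with hψ
  have hs : ContDiffAt ℝ ∞ ψ y :=
    ((hΨ (φ.symm y)).comp y (contMDiffAt_chart_symm hφ hy)).contDiffAt
  have hinv : ContDiffAt ℝ ∞ (fun z => (ψ z)⁻¹) y := hs.inv (hU _ hyU)
  have h1 : ∀ i j, pd i (fun z => formComp (logDifferential Ψ) φ z j) y =
      -((ψ y)⁻¹) ^ 2 * pd i ψ y * pd j ψ y + (ψ y)⁻¹ * pd i (pd j ψ) y := by
    intro i j
    rw [pd_congr (h := fun z => (ψ z)⁻¹ * pd j ψ z) (Filter.eventually_of_mem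
      (φ.open_target.mem_nhds hy) fun z hz => formComp_logDifferential hΨ hφ hz j),
      pd_mul (differentiableAt_of_smooth hinv) (differentiableAt_of_smooth (smooth_pd hs))]
    have h2 : pd i (fun z => (ψ z)⁻¹) y = -((ψ y)⁻¹) ^ 2 * pd i ψ y := by
      have h3 := pd_mul (i := i) (differentiableAt_of_smooth hinv) (differentiableAt_of_smooth hs)
      rw [pd_congr (h := fun _ => 1) ((hs.continuousAt.eventually_ne (hU _ hyU)).mono
        fun z hz => inv_mul_cancel₀ hz), pd_const] at h3
      have h4 : ψ y ≠ 0 := hU _ hyU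
      field_simp at h3 ⊢
      linarith
    rw [h2]
  intro i j
  rw [h1, h1, pd_comm hs]
  ring

end Global

end PPWave

/-! ### Assembly of the theorem. -/

open PPWave in
theorem lemma3p1 {n : ℕ} (hn : 4 ≤ n) {M : Type*} [TopologicalSpace M]
    [ChartedSpace (PPWave.Coord n) M] [IsManifold (𝓡 n) ∞ M]
    (g : PPWave.LorentzMetric n M) (hg : g.IsPPWave) :
    (∃ θ : (p : M) → TangentSpace (𝓡 n) p →L[ℝ] ℝ,
      PPWave.SmoothFormOn θ g.ricciNonzeroSet ∧
      PPWave.ClosedFormOn θ g.ricciNonzeroSet ∧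
      g.RicciRecurrentOn θ g.ricciNonzeroSet) ∧
    (∀ φ ∈ PPWave.charts n M, ∀ y ∈ φ.target, ∀ i j k l : Fin n,
      PPWave.covCovRicci (g.comp φ) y i j k l - PPWave.covCovRicci (g.comp φ) y j i k l = 0) ∧
    (∀ φ ∈ PPWave.charts n M, ∀ y ∈ φ.target, ∀ k l : Fin n,
      PPWave.divDivWeyl (g.comp φ) y k l =
        -(((n : ℝ) - 3) / ((n : ℝ) - 2)) * PPWave.laplacianRicci (g.comp φ) y k l) ∧
    (∀ φ ∈ PPWave.charts n M, ∀ y ∈ φ.target, ∀ k l : Fin n,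
      PPWave.laplacianRicci (g.comp φ) y k l = 0 ↔
        PPWave.divDivWeyl (g.comp φ) y k l = 0) := by
  obtain ⟨⟨X, hX⟩, hpp⟩ := hg
  obtain ⟨Ψ, hΨ⟩ := exists_global_factor hX hpp
  have hG := fun φ (hφ : φ ∈ charts n M) => isMetricOn_comp g hφ
  have hξ := fun φ (hφ : φ ∈ charts n M) => isParallelNullOn_dualComp hX hφ
  have hΨs : ∀ p, ContMDiffAt (𝓡 n) 𝓘(ℝ, ℝ) ∞ Ψ p :=
    contMDiffAt_of_smooth_in_charts fun φ hφ y hy =>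
      (hξ φ hφ).smooth_ricci_factor (hG φ hφ) (ψ := fun z => Ψ (φ.symm z)) (hΨ φ hφ) hy
  have hU : ∀ p ∈ g.ricciNonzeroSet, Ψ p ≠ 0 := by
    rintro p ⟨φ, hφ, hp, k, l, hkl⟩ h0
    rw [hΨ φ hφ _ (φ.map_source hp), φ.left_inv hp, h0, zero_mul] at hkl
    exact hkl rfl
  have hn4 : (4 : ℝ) ≤ n := by exact_mod_cast hn
  have hn2 : (n : ℝ) - 2 ≠ 0 := by linarith
  have hn3 : (n : ℝ) - 3 ≠ 0 := by linarith
  have hdiv : ∀ φ ∈ charts n M, ∀ y ∈ φ.target, ∀ k l : Fin n,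
      divDivWeyl (g.comp φ) y k l =
        -(((n : ℝ) - 3) / ((n : ℝ) - 2)) * laplacianRicci (g.comp φ) y k l :=
    fun φ hφ y hy k l => (hξ φ hφ).divDivWeyl_eq (hG φ hφ) (ψ := fun z => Ψ (φ.symm z))
      (hΨ φ hφ) hn2 hy k l
  -- The recurrence form is dΨ/Ψ. Where the Ricci tensor vanishes Ψ = 0, and the convention 0⁻¹ = 0
  -- makes the form zero there; nothing is claimed at those points.
  refine ⟨⟨logDifferential Ψ, smoothFormOn_logDifferential hΨs hU,
    closedFormOn_logDifferential hΨs hU, fun φ hφ y hy hyU j k l => ?_⟩,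
    fun φ hφ y hy i j k l => ?_, hdiv, fun φ hφ y hy k l => ?_⟩
  · rw [covRicci_eq, (hξ φ hφ).nabla2_ricci (hG φ hφ) (ψ := fun z => Ψ (φ.symm z)) (hΨ φ hφ) hy,
      formComp_logDifferential hΨs hφ hy, hΨ φ hφ y hy]
    have := hU _ hyU
    field_simp
  · have hs := (hξ φ hφ).smooth_ricci_factor (hG φ hφ) (ψ := fun z => Ψ (φ.symm z)) (hΨ φ hφ) hy
    rw [covCovRicci_eq, covCovRicci_eq,
      (hξ φ hφ).nabla3_nabla2_ricci (hG φ hφ) (ψ := fun z => Ψ (φ.symm z)) (hΨ φ hφ) hy,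
      (hξ φ hφ).nabla3_nabla2_ricci (hG φ hφ) (ψ := fun z => Ψ (φ.symm z)) (hΨ φ hφ) hy,
      IsParallelNullOn.hessian_symm (hG φ hφ) hy hs i j, sub_self]
  · rw [hdiv φ hφ y hy k l]
    constructor
    · intro h
      rw [h, mul_zero]
    · intro h
      -- The factor (n-3)/(n-2) is nonzero because n ≥ 4.
      exact (mul_eq_zero.1 h).resolve_left (neg_ne_zero.2 (div_ne_zero hn3 hn2))
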